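/- Consider the two-input control system $$\dot x_1=u_1,\qquad \dot x_2=u_2,\qquad \dot x_3=x_1+\frac{u_2^2}{2u_1}$$ on the set $\{(x,u)\in\mathbb R^3\times\mathbb R^2 : u_1\neq 0\}$. For a two-input system $\dot x=f(x,u)$ and a smooth function $h(x,u,\dot u,\ldots,u^{(k)})$, the time derivative along the system is $\dot h=\sum_i \frac{\partial h}{\partial x_i}f_i(x,u)+\sum_{\alpha=0}^{k}\sum_j\frac{\partial h}{\partial u_j^{(\alpha)}}u_j^{(\alpha+1)}$. A pair $\varphi=(\varphi_1,\varphi_2)$ of functions of $(x,u,\dot u,\ldots,u^{(q)})$ is called an $(x,u,\ldots,u^{(q)})$-flat output around a point $(x,u,\dot u,\ddot u,\ldots)$ with $(x,u)$ in the domain of the system if $\varphi$ is smooth near this point and there are an integer $r\ge 0$ and smooth maps $F_x,F_u$ such that $$x=F_x(\varphi,\dot\varphi,\ldots,\varphi^{(r-1)}),\qquad u=F_u(\varphi,\dot\varphi,\ldots,\varphi^{(r)})$$ holds on a neighbourhood of this point, where neighbourhoods are taken in the product topology on the space of all $(x,u,\dot u,\ddot u,\ldots)$, i.e. they restrict only finitely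 many of the coordinates. 1. The pair $$y_1=\frac{u_2}{u_1},$$ $$y_2=2x_2-\frac{2}{u_1}(x_1u_2-x_3\dot u_2)-2\frac{u_2}{u_1^2}(x_2\dot u_2+x_3\dot u_1)+\frac{u_2^2}{u_1^3}(x_1\dot u_2+2x_2\dot u_1)-\frac{1}{u_1^4}x_1\dot u_1u_2^3$$ is an $(x,u,\dot u)$-flat output of the system around every point with $u_1\ne 0$ and $\dot y_1^3+\ddot y_1\neq 0$, and the set of these points is open and dense. In particular, the system is flat. 2. The system does not possess any $(x,u)$-flat output: no pair $\varphi(x,u)$ of functions is a flat output of the system around any point. Hence the conjecture that every flat system possesses an $(x,u)$-flat output is false. -/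

import Mathlib

open Topology
open scoped ContDiff

noncomputable section

/-- A smooth control system `ẋ = f(x, u)` with `n` states and `m` inputs, in coordinates, defined on
an open set of pairs `(x, u)`. -/
structure ControlSystem (n m : ℕ) where
  /-- the domain of the right-hand side -/
  domain : Set ((Fin n → ℝ) × (Fin m → ℝ))
  isOpen_domain : IsOpen domain
  /-- the right-hand side -/
  f : (Fin n → ℝ) × (Fin m → ℝ) → (Fin n → ℝ)
  contDiffOn_f : ContDiffOn ℝ ∞ f domain

/-- The space with coordinates `(x, u, u̇, …, u^(k))`; the second component of `ξ` is
`(u, u̇, …, u^(k))`, so that `ξ.2 i` is the `i`-th time derivative of the input. -/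
abbrev Jet (n m k : ℕ) : Type := (Fin n → ℝ) × (Fin (k + 1) → Fin m → ℝ)

/-- The space with coordinates `(x, u, u̇, ü, …)`, with the product topology: an open set restricts
only finitely many of the coordinates. -/
abbrev InfJet (n m : ℕ) : Type := (Fin n → ℝ) × (ℕ → Fin m → ℝ)

/-- `(x, u, u̇, …) ↦ (x, u, …, u^(k))`. -/
def InfJet.trunc {n m : ℕ} (k : ℕ) (ξ : InfJet n m) : Jet n m k :=
  (ξ.1, fun i => ξ.2 i)

/-- The time derivative along the system of a function `h(x, u, …, u^(k))`, which is a function of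
`(x, u, …, u^(k+1))`:
`ḣ = ∑ᵢ (∂h/∂xᵢ) fᵢ(x, u) + ∑_{α ≤ k} ∑ⱼ (∂h/∂uⱼ^(α)) uⱼ^(α+1)`. -/
def ControlSystem.timeDeriv {n m k : ℕ} (S : ControlSystem n m)
    (h : Jet n m k → (Fin m → ℝ)) (ξ : Jet n m (k + 1)) : Fin m → ℝ :=
  fderiv ℝ h (ξ.1, fun i => ξ.2 i.castSucc) (S.f (ξ.1, ξ.2 0), fun i => ξ.2 i.succ)

/-- The `j`-th time derivative along the system of `h(x, u, …, u^(q))`, a function of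
`(x, u, …, u^(q+j))`. -/
def ControlSystem.iterTimeDeriv {n m q : ℕ} (S : ControlSystem n m)
    (h : Jet n m q → (Fin m → ℝ)) : (j : ℕ) → Jet n m (q + j) → (Fin m → ℝ)
  | 0 => h
  | j + 1 => S.timeDeriv (S.iterTimeDeriv h j)

/-- The first `r` functions `φ, φ̇, …, φ^(r-1)` evaluated at the point `ξ = (x, u, u̇, …)`. -/
def ControlSystem.outputJet {n m q : ℕ} (S : ControlSystem n m)
    (φ : Jet n m q → (Fin m → ℝ)) (r : ℕ) (ξ : InfJet n m) : Fin r → Fin m → ℝ :=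
  fun j => S.iterTimeDeriv φ j (ξ.trunc (q + j))

/-- `g` is smooth on some open neighbourhood of `p`. -/
def SmoothNear {E F : Type*} [NormedAddCommGroup E] [NormedSpace ℝ E]
    [NormedAddCommGroup F] [NormedSpace ℝ F] (g : E → F) (p : E) : Prop :=
  ∃ U : Set E, IsOpen U ∧ p ∈ U ∧ ContDiffOn ℝ ∞ g U

/-- `φ(x, u, …, u^(q))` is a flat output of the system locally around `ξ₀ = (x, u, u̇, …)`:
it has as many components as there are inputs, it is smooth near `ξ₀`, and there are `r` and smooth
maps `F_x`, `F_u` with `x = F_x(φ, …, φ^(r-1))` and `u = F_u(φ, …, φ^(r))` near `ξ₀`. -/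
def ControlSystem.IsFlatOutputAt {n m q : ℕ} (S : ControlSystem n m)
    (φ : Jet n m q → (Fin m → ℝ)) (ξ₀ : InfJet n m) : Prop :=
  (ξ₀.1, ξ₀.2 0) ∈ S.domain ∧
  SmoothNear φ (ξ₀.trunc q) ∧
  ∃ (r : ℕ) (Fx : (Fin r → Fin m → ℝ) → (Fin n → ℝ)) (Fu : (Fin (r + 1) → Fin m → ℝ) → (Fin m → ℝ)),
    SmoothNear Fx (S.outputJet φ r ξ₀) ∧
    SmoothNear Fu (S.outputJet φ (r + 1) ξ₀) ∧
    ∀ᶠ ξ in 𝓝 ξ₀, ξ.1 = Fx (S.outputJet φ r ξ) ∧ ξ.2 0 = Fu (S.outputJet φ (r + 1) ξ)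

/-- The system possesses, locally around at least one point, a flat output that depends only on
`(x, u, u̇, …, u^(q))`. For `q = 0` this is an `(x, u)`-flat output. -/
def ControlSystem.HasFlatOutput {n m : ℕ} (S : ControlSystem n m) (q : ℕ) : Prop :=
  ∃ (φ : Jet n m q → (Fin m → ℝ)) (ξ₀ : InfJet n m), S.IsFlatOutputAt φ ξ₀

/-- The system `ẋ₁ = u₁`, `ẋ₂ = u₂`, `ẋ₃ = x₁ + u₂² / (2 u₁)` on the set where `u₁ ≠ 0`. -/
def exampleSystem : ControlSystem 3 2 where
  domain := {p | p.2 0 ≠ 0}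
  isOpen_domain := isOpen_ne_fun (by fun_prop) continuous_const
  f := fun p => ![p.2 0, p.2 1, p.1 0 + (p.2 1) ^ 2 / (2 * p.2 0)]
  contDiffOn_f := by
    rw [contDiffOn_pi]
    intro i
    fin_cases i
    · exact ContDiff.contDiffOn (f := fun p : (Fin 3 → ℝ) × (Fin 2 → ℝ) => p.2 0) (by fun_prop)
    · exact ContDiff.contDiffOn (f := fun p : (Fin 3 → ℝ) × (Fin 2 → ℝ) => p.2 1) (by fun_prop)
    · refine ContDiffOn.add (f := fun p : (Fin 3 → ℝ) × (Fin 2 → ℝ) => p.1 0)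
        (ContDiff.contDiffOn (by fun_prop)) (ContDiffOn.div (ContDiff.contDiffOn (by fun_prop))
          (ContDiff.contDiffOn (by fun_prop)) ?_)
      intro p hp
      exact mul_ne_zero two_ne_zero hp

/-- The functions
`y₁ = u₂/u₁` and
`y₂ = 2x₂ - (2/u₁)(x₁u₂ - x₃u̇₂) - 2(u₂/u₁²)(x₂u̇₂ + x₃u̇₁) + (u₂²/u₁³)(x₁u̇₂ + 2x₂u̇₁) - x₁u̇₁u₂³/u₁⁴`
of `(x, u, u̇)`. -/
def exampleOutput (ξ : Jet 3 2 1) : Fin 2 → ℝ :=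
  let x₁ := ξ.1 0
  let x₂ := ξ.1 1
  let x₃ := ξ.1 2
  let u₁ := ξ.2 0 0
  let u₂ := ξ.2 0 1
  let du₁ := ξ.2 1 0
  let du₂ := ξ.2 1 1
  ![u₂ / u₁,
    2 * x₂ - 2 / u₁ * (x₁ * u₂ - x₃ * du₂) - 2 * (u₂ / u₁ ^ 2) * (x₂ * du₂ + x₃ * du₁)
      + u₂ ^ 2 / u₁ ^ 3 * (x₁ * du₂ + 2 * x₂ * du₁) - 1 / u₁ ^ 4 * (x₁ * du₁ * u₂ ^ 3)]

/-- The points `(x, u, u̇, …)` with `u₁ ≠ 0` and `ẏ₁³ + ÿ₁ ≠ 0`, where `y₁ = u₂/u₁`. -/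
def exampleRegularSet : Set (InfJet 3 2) :=
  {ξ | ξ.2 0 0 ≠ 0 ∧
    (exampleSystem.outputJet exampleOutput 3 ξ 1 0) ^ 3 +
      exampleSystem.outputJet exampleOutput 3 ξ 2 0 ≠ 0}

end

/-!
# A flat system without an `(x, u)`-flat output

Everything is computed on the jets `(x, u, u̇, …, u^(L))` of a large fixed order `L`, where the time
derivative is the derivative `lieD V` along a vector field `V` (`IsJetField`,
`ControlSystem.iterTimeDeriv_jetRes`). It commutes with the derivative in a constant direction `e`
up to the derivative along `∂V/∂e` (`fderiv_lieD_apply`), and all facts about the orders of iterated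
derivatives follow from this.

**The explicit output.** Put `p = u₂ / u₁`, `a = x₂ - p x₁` and `b = x₃ - p² x₁ / 2`. Then
`ȧ = -ṗ x₁` and `ḃ = (1 - p ṗ) x₁`, so that `(1 - p ṗ) ȧ + ṗ ḃ = 0`, and
`y₂ = 2 (1 - p ṗ) a + 2 ṗ b`. Hence `ẏ₂ = -2 (ṗ² + p p̈) a + 2 p̈ b`, and `y₂`, `ẏ₂` are linear
in `(a, b)` with determinant proportional to `ṗ³ + p̈`. They give `a` and `b`; then `ÿ₂`
gives `x₁`, hence the state, and its third derivative gives `u₁`, each time with coefficient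
`2 (ṗ³ + p̈)`.

**No output `φ(x, u)`.** Flatness implies that no tangent vector with a nonzero component along
`(x, u)` annihilates all the derivatives of `φ` (`ControlSystem.IsFlatOutputAt.exists_determined`).
Let `y` be a component of `φ` that depends on the input or, if `φ = φ(x)`, the time derivative of a
component `c(x)`; one of them depends on the input, for otherwise `φ` would be constant. Take
`y` as a new input, together with one of the old inputs, `s` (`false_of_determined`). The
tangent vectors that annihilate all `y^(i)` are those without component along `y, ẏ, …`. Let `h` be
the other component of `φ`, and `h^(j)` its first derivative that depends on `s`. Because the
variations of `s, ṡ, …` can be chosen so as to annihilate `h^(j), h^(j+1), …`, the differentials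
`d_x c` and `d_x h^(i)` with `i < j` must span the dual of the state space. All of them except the
last, `d_x h^(j-1)`, annihilate `∂f/∂s`, because `h^(i+1)` does not depend on `s`; therefore `∂f/∂s`
spans their common kernel, and its direction does not depend on `s`
(`IsNormalForm.exists_fderiv_sVelocity_eq_smul`). For fixed `x` the velocities form a nondegenerate
quadratic cone, which contains no lines except its rulings, so `∂f/∂s` is parallel to
`(1, p, p² / 2)` (`IsNormalForm.exists_ruling_eq_smul`).

If `c` is present, then `d_x c` annihilates the rulings and `y = ċ = x₁ ∂c/∂x₃` is a function of
`x`, which is absurd. Otherwise `j ≥ 3`, and both `d_x h` and `d_x ḣ` annihilate the rulings. The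
ruling turns with nonzero speed as `y` varies, and differentiating these relations
with respect to `y`, `ẏ` and `x₃` gives `d_x h = 0` (`IsNormalForm.fderiv_stateDir_eq_zero`). Then
no derivative of `h` depends on `x`, again a contradiction (`IsNormalForm.elim`).
-/

noncomputable section

/-! ### Derivatives along vector fields -/

section LieDerivative

variable {E : Type*} [NormedAddCommGroup E] [NormedSpace ℝ E]

/-- The derivative of the function `h` along the vector field `V`. -/
def lieD (V : E → E) (h : E → ℝ) : E → ℝ := fun ζ => fderiv ℝ h ζ (V ζ)

variable {O : Set E} {V : E → E} {g h : E → ℝ} {ζ : E}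

theorem ContDiffOn.differentiableAt_of_isOpen {F : Type*} [NormedAddCommGroup F] [NormedSpace ℝ F]
    {f : E → F} (hf : ContDiffOn ℝ ∞ f O) (hO : IsOpen O) (hζ : ζ ∈ O) :
    DifferentiableAt ℝ f ζ :=
  (hf.contDiffAt (hO.mem_nhds hζ)).differentiableAt (by simp)

theorem ContDiffOn.lieD (hO : IsOpen O) (hV : ContDiffOn ℝ ∞ V O) (hh : ContDiffOn ℝ ∞ h O) :
    ContDiffOn ℝ ∞ (lieD V h) O :=
  (hh.fderiv_of_isOpen hO (by simp)).clm_apply hV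

theorem ContDiffOn.iterate_lieD (hO : IsOpen O) (hV : ContDiffOn ℝ ∞ V O)
    (hh : ContDiffOn ℝ ∞ h O) (i : ℕ) : ContDiffOn ℝ ∞ ((_root_.lieD V)^[i] h) O := by
  induction i with
  | zero => exact hh
  | succ i ih => rw [Function.iterate_succ_apply']; exact ContDiffOn.lieD hO hV ih

theorem ContDiffOn.fderiv_apply_const (hO : IsOpen O) (hh : ContDiffOn ℝ ∞ h O) (e : E) :
    ContDiffOn ℝ ∞ (fun ζ => fderiv ℝ h ζ e) O :=
  (hh.fderiv_of_isOpen hO (by simp)).clm_apply contDiffOn_const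

theorem Set.EqOn.fderiv_eq_of_isOpen {F : Type*} [NormedAddCommGroup F] [NormedSpace ℝ F]
    {f₁ f₂ : E → F} (h12 : Set.EqOn f₁ f₂ O) (hO : IsOpen O) (hζ : ζ ∈ O) :
    fderiv ℝ f₁ ζ = fderiv ℝ f₂ ζ :=
  (h12.eventuallyEq_of_mem (hO.mem_nhds hζ)).fderiv_eq

theorem Set.EqOn.lieD (hO : IsOpen O) (h12 : Set.EqOn g h O) :
    Set.EqOn (lieD V g) (lieD V h) O := fun ζ hζ => by
  simp only [_root_.lieD, h12.fderiv_eq_of_isOpen hO hζ]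

theorem fderiv_eq_zero_of_eqOn_const {c : ℝ} (hO : IsOpen O) (hg : ∀ ζ ∈ O, g ζ = c)
    (hζ : ζ ∈ O) : fderiv ℝ g ζ = 0 := by
  have : Set.EqOn g (fun _ => c) O := hg
  rw [this.fderiv_eq_of_isOpen hO hζ, fderiv_fun_const]; rfl

theorem lieD_eq_zero_of_eqOn_const {c : ℝ} (hO : IsOpen O) (hg : ∀ ζ ∈ O, g ζ = c)
    (hζ : ζ ∈ O) : lieD V g ζ = 0 := by
  simp [lieD, fderiv_eq_zero_of_eqOn_const hO hg hζ]

/-- The derivative in a constant direction `e` and the derivative along `V` commute up to the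
derivative along `∂V/∂e`. -/
theorem fderiv_lieD_apply (hO : IsOpen O) (hV : ContDiffOn ℝ ∞ V O) (hh : ContDiffOn ℝ ∞ h O)
    (hζ : ζ ∈ O) (e : E) :
    fderiv ℝ (lieD V h) ζ e =
      lieD V (fun ζ => fderiv ℝ h ζ e) ζ + fderiv ℝ h ζ (fderiv ℝ V ζ e) := by
  have h1 := ((hh.fderiv_of_isOpen (m := ∞) hO (by simp)).differentiableAt_of_isOpen
    hO hζ).hasFDerivAt
  have h2 := (hV.differentiableAt_of_isOpen hO hζ).hasFDerivAt
  have h3 := (h1.clm_apply h2).fderiv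
  have h4 := (h1.clm_apply (hasFDerivAt_const e ζ)).fderiv
  have hs : IsSymmSndFDerivAt ℝ h ζ :=
    (hh.contDiffAt (hO.mem_nhds hζ)).isSymmSndFDerivAt (by
      rw [minSmoothness_of_isRCLikeNormedField]; exact WithTop.coe_le_coe.2 le_top)
  unfold lieD
  rw [h3, h4]
  simp [hs.eq e (V ζ), add_comm]

theorem fderiv_fderiv_comm (hO : IsOpen O) (hh : ContDiffOn ℝ ∞ h O) (hζ : ζ ∈ O) (e e' : E) :
    fderiv ℝ (fun ζ => fderiv ℝ h ζ e') ζ e = fderiv ℝ (fun ζ => fderiv ℝ h ζ e) ζ e' := by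
  have := fderiv_lieD_apply hO (V := fun _ => e') contDiffOn_const hh hζ e
  rw [fderiv_fun_const, Pi.zero_apply, zero_apply, map_zero, add_zero] at this
  exact this

end LieDerivative

/-! ### Vector fields on jet spaces -/

section JetFields

variable {n m L : ℕ}

/-- The constant vector on the jet space in the direction of the state. -/
def stateDir (m L : ℕ) (e : Fin n → ℝ) : Jet n m L := (e, 0)

/-- The constant vector on the jet space in the direction `v` of the `l`-th derivative of the
input; it is zero if `l > L`. -/
def inputDir (n L l : ℕ) (v : Fin m → ℝ) : Jet n m L := (0, fun i => if i.val = l then v else 0)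

theorem inputDir_add (l : ℕ) (v w : Fin m → ℝ) :
    inputDir n L l (v + w) = inputDir n L l v + inputDir n L l w := by
  refine Prod.ext (by simp [inputDir]) (funext fun i => ?_)
  by_cases h : i.val = l <;> simp [inputDir, h]

theorem inputDir_smul (l : ℕ) (c : ℝ) (v : Fin m → ℝ) :
    inputDir n L l (c • v) = c • inputDir n L l v := by
  refine Prod.ext (by simp [inputDir]) (funext fun i => ?_)
  by_cases h : i.val = l <;> simp [inputDir, h]

theorem stateDir_add (e e' : Fin n → ℝ) :
    stateDir m L (e + e') = stateDir m L e + stateDir m L e' := by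
  simp [stateDir]

theorem stateDir_smul (c : ℝ) (e : Fin n → ℝ) :
    stateDir m L (c • e) = c • stateDir m L e := by
  simp [stateDir]

theorem stateDir_add_sum_inputDir (δ : Jet n m L) :
    stateDir m L δ.1 + ∑ i : Fin (L + 1), inputDir n L i (δ.2 i) = δ := by
  refine Prod.ext (by simp [stateDir, inputDir, Prod.fst_sum]) (funext fun i => ?_)
  simp [stateDir, inputDir, Prod.snd_sum, Finset.sum_apply, Fin.val_inj]

theorem hasFDerivAt_state (ζ : Jet n m L) (k : Fin n) :
    HasFDerivAt (fun ζ : Jet n m L => ζ.1 k) ((ContinuousLinearMap.proj (R := ℝ) k).comp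
      (ContinuousLinearMap.fst ℝ (Fin n → ℝ) (Fin (L + 1) → Fin m → ℝ))) ζ :=
  let P : Jet n m L →L[ℝ] ℝ := (ContinuousLinearMap.proj k).comp (ContinuousLinearMap.fst ℝ _ _)
  P.hasFDerivAt

theorem hasFDerivAt_input (ζ : Jet n m L) (i : Fin (L + 1)) (a : Fin m) :
    HasFDerivAt (fun ζ : Jet n m L => ζ.2 i a) ((ContinuousLinearMap.proj (R := ℝ) a).comp
      ((ContinuousLinearMap.proj (R := ℝ) (φ := fun _ : Fin (L + 1) => Fin m → ℝ) i).comp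
        (ContinuousLinearMap.snd ℝ (Fin n → ℝ) (Fin (L + 1) → Fin m → ℝ)))) ζ :=
  let P : Jet n m L →L[ℝ] ℝ := (ContinuousLinearMap.proj a).comp
    ((ContinuousLinearMap.proj (φ := fun _ : Fin (L + 1) => Fin m → ℝ) i).comp
      (ContinuousLinearMap.snd ℝ _ _))
  P.hasFDerivAt

/-- Two tangent vectors that agree except in the highest derivative of the input differ by a vector
in the direction of that derivative. -/
theorem exists_eq_add_inputDir {a b : Jet n m L} (h1 : a.1 = b.1)
    (h2 : ∀ l : Fin L, a.2 l.castSucc = b.2 l.castSucc) : ∃ w, a = b + inputDir n L L w := by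
  refine ⟨a.2 (Fin.last L) - b.2 (Fin.last L), Prod.ext (by simp [inputDir, h1])
    (funext fun i => ?_)⟩
  induction i using Fin.lastCases with
  | last => simp [inputDir]
  | cast i => simp [inputDir, h2, i.2.ne]

/-- `h` depends, infinitesimally on `O`, only on the state and on the derivatives of the input of
order less than `k`. -/
def OrderLT (O : Set (Jet n m L)) (k : ℕ) (h : Jet n m L → ℝ) : Prop :=
  ∀ ζ ∈ O, ∀ l, k ≤ l → ∀ v, fderiv ℝ h ζ (inputDir n L l v) = 0

theorem OrderLT.mono {O : Set (Jet n m L)} {k k' : ℕ} {h : Jet n m L → ℝ} (hh : OrderLT O k h)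
    (hk : k ≤ k') : OrderLT O k' h := fun ζ hζ l hl v => hh ζ hζ l (hk.trans hl) v

/-- A vector field of the form `(f(x, u), u̇, …, u^(L), *)` on the space of jets of order `L`, on an
open set `O`. Truncating the space of all jets leaves the last component without meaning, hence
it is arbitrary here; it does not matter for functions of order less than `L`. -/
structure IsJetField (O : Set (Jet n m L)) (V : Jet n m L → Jet n m L) : Prop where
  isOpen : IsOpen O
  smooth : ContDiffOn ℝ ∞ V O
  shift : ∀ ζ ∈ O, ∀ l : Fin L, (V ζ).2 l.castSucc = ζ.2 l.succ
  state : ∀ ζ ∈ O, ∀ l, 1 ≤ l → ∀ v, (fderiv ℝ V ζ (inputDir n L l v)).1 = 0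

namespace IsJetField

variable {O : Set (Jet n m L)} {V : Jet n m L → Jet n m L} {h : Jet n m L → ℝ} {ζ : Jet n m L}
  {k : ℕ}

theorem mono {O' : Set (Jet n m L)} (hV : IsJetField O V) (hO' : IsOpen O') (hsub : O' ⊆ O) :
    IsJetField O' V :=
  ⟨hO', hV.smooth.mono hsub, fun ζ hζ => hV.shift ζ (hsub hζ), fun ζ hζ => hV.state ζ (hsub hζ)⟩

theorem fderiv_shift (hV : IsJetField O V) (hζ : ζ ∈ O) (e : Jet n m L) (l : Fin L) :
    (fderiv ℝ V ζ e).2 l.castSucc = e.2 l.succ := by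
  let P (i : Fin (L + 1)) : Jet n m L →L[ℝ] (Fin m → ℝ) :=
    (ContinuousLinearMap.proj i).comp (ContinuousLinearMap.snd ℝ _ _)
  have h1 : Set.EqOn (fun ζ => P l.castSucc (V ζ)) (P l.succ) O := fun ζ hζ => hV.shift ζ hζ l
  have h2 := h1.fderiv_eq_of_isOpen hV.isOpen hζ
  have h3 := ((P l.castSucc).hasFDerivAt.comp ζ
    (hV.smooth.differentiableAt_of_isOpen hV.isOpen hζ).hasFDerivAt).fderiv
  have h4 : fderiv ℝ (fun ζ => P l.castSucc (V ζ)) ζ e = P l.castSucc (fderiv ℝ V ζ e) := by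
    exact congrArg (fun T => T e) h3
  rw [h2, ContinuousLinearMap.fderiv] at h4
  exact h4.symm

theorem fderiv_apply_of_order (hord : OrderLT O L h) (hζ : ζ ∈ O) {a b : Jet n m L}
    (h1 : a.1 = b.1) (h2 : ∀ l : Fin L, a.2 l.castSucc = b.2 l.castSucc) :
    fderiv ℝ h ζ a = fderiv ℝ h ζ b := by
  obtain ⟨w, rfl⟩ := exists_eq_add_inputDir h1 h2
  rw [map_add, hord ζ hζ L le_rfl, add_zero]

theorem fderiv_lieD_inputDir_succ (hV : IsJetField O V) (hh : ContDiffOn ℝ ∞ h O)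
    (hord : OrderLT O L h) (hζ : ζ ∈ O) (l : ℕ) (v : Fin m → ℝ) :
    fderiv ℝ (lieD V h) ζ (inputDir n L (l + 1) v) =
      lieD V (fun ζ => fderiv ℝ h ζ (inputDir n L (l + 1) v)) ζ +
        fderiv ℝ h ζ (inputDir n L l v) := by
  rw [fderiv_lieD_apply hV.isOpen hV.smooth hh hζ]
  congr 1
  refine fderiv_apply_of_order hord hζ ?_ fun i => ?_
  · rw [hV.state ζ hζ _ (by omega)]; rfl
  · rw [hV.fderiv_shift hζ]; simp [inputDir]

theorem fderiv_lieD_inputDir_zero (hV : IsJetField O V) (hh : ContDiffOn ℝ ∞ h O)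
    (hord : OrderLT O L h) (hζ : ζ ∈ O) (v : Fin m → ℝ) :
    fderiv ℝ (lieD V h) ζ (inputDir n L 0 v) =
      lieD V (fun ζ => fderiv ℝ h ζ (inputDir n L 0 v)) ζ +
        fderiv ℝ h ζ (stateDir m L (fderiv ℝ V ζ (inputDir n L 0 v)).1) := by
  rw [fderiv_lieD_apply hV.isOpen hV.smooth hh hζ]
  congr 1
  refine fderiv_apply_of_order hord hζ rfl fun i => ?_
  rw [hV.fderiv_shift hζ]; simp [inputDir, stateDir]

theorem fderiv_lieD_stateDir (hV : IsJetField O V) (hh : ContDiffOn ℝ ∞ h O)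
    (hord : OrderLT O L h) (hζ : ζ ∈ O) (e : Fin n → ℝ) :
    fderiv ℝ (lieD V h) ζ (stateDir m L e) =
      lieD V (fun ζ => fderiv ℝ h ζ (stateDir m L e)) ζ +
        fderiv ℝ h ζ (stateDir m L (fderiv ℝ V ζ (stateDir m L e)).1) := by
  rw [fderiv_lieD_apply hV.isOpen hV.smooth hh hζ]
  congr 1
  refine fderiv_apply_of_order hord hζ rfl fun i => ?_
  rw [hV.fderiv_shift hζ]; simp [stateDir]

theorem contDiffOn_iterate (hV : IsJetField O V) (hh : ContDiffOn ℝ ∞ h O) (i : ℕ) :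
    ContDiffOn ℝ ∞ ((lieD V)^[i] h) O := ContDiffOn.iterate_lieD hV.isOpen hV.smooth hh i

theorem orderLT_lieD (hV : IsJetField O V) (hh : ContDiffOn ℝ ∞ h O) (hord : OrderLT O k h)
    (hk : k ≤ L) : OrderLT O (k + 1) (lieD V h) := by
  rintro ζ hζ (_ | l) hl v
  · omega
  rw [hV.fderiv_lieD_inputDir_succ hh (hord.mono hk) hζ, hord ζ hζ l (by omega),
    lieD_eq_zero_of_eqOn_const hV.isOpen (fun ζ hζ => hord ζ hζ _ (by omega) v) hζ, add_zero]

theorem orderLT_iterate (hV : IsJetField O V) (hh : ContDiffOn ℝ ∞ h O) (hord : OrderLT O k h)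
    (i : ℕ) (hi : k + i ≤ L + 1) : OrderLT O (k + i) ((lieD V)^[i] h) := by
  induction i with
  | zero => exact hord
  | succ i ih =>
    rw [Function.iterate_succ_apply', ← add_assoc]
    exact hV.orderLT_lieD (hV.contDiffOn_iterate hh i) (ih (by omega)) (by omega)

/-- The derivative of `h^(i)` with respect to `u^(k+i)` is the derivative of `h` with respect to
`u^(k)`, if `h` has order at most `k`. -/
theorem fderiv_iterate_inputDir (hV : IsJetField O V) (hh : ContDiffOn ℝ ∞ h O)
    (hord : OrderLT O (k + 1) h) (i : ℕ) (hi : k + i ≤ L) (hζ : ζ ∈ O) (v : Fin m → ℝ) :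
    fderiv ℝ ((lieD V)^[i] h) ζ (inputDir n L (k + i) v) =
      fderiv ℝ h ζ (inputDir n L k v) := by
  induction i with
  | zero => rfl
  | succ i ih =>
    have ho := hV.orderLT_iterate hh hord i (by omega)
    rw [Function.iterate_succ_apply', ← add_assoc, hV.fderiv_lieD_inputDir_succ
      (hV.contDiffOn_iterate hh i) (ho.mono (by omega)) hζ, ih (by omega),
      lieD_eq_zero_of_eqOn_const hV.isOpen (fun ζ hζ => ho ζ hζ _ (by omega) v) hζ, zero_add]

end IsJetField

/-- A lower triangular linear system with nonzero diagonal entries is solvable. -/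
theorem exists_solution_of_lowerTriangular (a : ℕ → ℕ → ℝ) (b : ℕ → ℝ) (M : ℕ)
    (hdiag : ∀ i < M, a i i ≠ 0) (htri : ∀ i < M, ∀ l, i < l → a i l = 0) :
    ∃ s : ℕ → ℝ, ∀ i < M, b i + ∑ l ∈ Finset.range M, a i l * s l = 0 := by
  induction M with
  | zero => exact ⟨0, by simp⟩
  | succ M ih =>
    obtain ⟨s, hs⟩ := ih (fun i hi => hdiag i (by omega)) (fun i hi => htri i (by omega))
    set t := -(b M + ∑ l ∈ Finset.range M, a M l * s l) / a M M with ht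
    refine ⟨Function.update s M t, fun i hi => ?_⟩
    have hsum : ∑ l ∈ Finset.range M, a i l * Function.update s M t l =
        ∑ l ∈ Finset.range M, a i l * s l :=
      Finset.sum_congr rfl fun l hl => by
        rw [Function.update_of_ne (by have := Finset.mem_range.1 hl; omega)]
    rw [Finset.sum_range_succ, hsum, Function.update_self]
    rcases (Nat.lt_succ_iff_lt_or_eq.1 hi) with h | rfl
    · rw [htri i hi M h, zero_mul, add_zero, hs i h]
    · have := hdiag i hi
      rw [ht]; field_simp; ring

end JetFields

/-! ### The normal form -/

section NormalForm

variable {L : ℕ}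

theorem fderiv_eq_add_of_orderLT_one {n m : ℕ} {O : Set (Jet n m L)} {h : Jet n m L → ℝ}
    (hord : OrderLT O 1 h) {ζ : Jet n m L} (hζ : ζ ∈ O) (δ : Jet n m L) :
    fderiv ℝ h ζ δ =
      fderiv ℝ h ζ (stateDir m L δ.1) + fderiv ℝ h ζ (inputDir n L 0 (δ.2 0)) := by
  conv_lhs => rw [← stateDir_add_sum_inputDir δ, map_add, map_sum, Fin.sum_univ_succ]
  rw [Finset.sum_eq_zero fun i _ => hord ζ hζ _ (by simp) _]
  simp

theorem map_stateDir_three {m : ℕ} (T : Jet 3 m L →L[ℝ] ℝ) (e : Fin 3 → ℝ) :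
    T (stateDir m L e) = e 0 * T (stateDir m L (Pi.single 0 1)) +
      e 1 * T (stateDir m L (Pi.single 1 1)) + e 2 * T (stateDir m L (Pi.single 2 1)) := by
  have : e = e 0 • Pi.single 0 1 + e 1 • Pi.single 1 1 + e 2 • Pi.single 2 1 := by
    ext i; fin_cases i <;> simp
  conv_lhs => rw [this]
  simp only [stateDir_add, stateDir_smul, map_add, map_smul, smul_eq_mul]

theorem map_inputDir_two {n : ℕ} (T : Jet n 2 L →L[ℝ] ℝ) (l : ℕ) (v : Fin 2 → ℝ) :
    T (inputDir n L l v) = v 0 * T (inputDir n L l (Pi.single 0 1)) +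
      v 1 * T (inputDir n L l (Pi.single 1 1)) := by
  have : v = v 0 • Pi.single 0 1 + v 1 • Pi.single 1 1 := by
    ext i; fin_cases i <;> simp
  conv_lhs => rw [this]
  simp only [inputDir_add, inputDir_smul, map_add, map_smul, smul_eq_mul]

theorem exists_ne_zero_stateDir_of_two {m : ℕ} (S T : Jet 3 m L →L[ℝ] ℝ) :
    ∃ e : Fin 3 → ℝ, e ≠ 0 ∧ S (stateDir m L e) = 0 ∧ T (stateDir m L e) = 0 := by
  let ι : (Fin 3 → ℝ) →ₗ[ℝ] Jet 3 m L := LinearMap.inl ℝ _ _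
  let F : (Fin 3 → ℝ) →ₗ[ℝ] ℝ × ℝ := (S.toLinearMap ∘ₗ ι).prod (T.toLinearMap ∘ₗ ι)
  have := LinearMap.ker_ne_bot_of_finrank_lt (f := F) (by simp)
  obtain ⟨e, he, hne⟩ := (Submodule.ne_bot_iff _).1 this
  have := Prod.ext_iff.1 (LinearMap.mem_ker.1 he)
  exact ⟨e, hne, this.1, this.2⟩

/-- The situation of a flat output `φ(x, u)` of the example system after a change of coordinates:
the inputs are now `y = ζ.2 0 0`, which is taken from the output, and `s = ζ.2 0 1`, and the old
inputs `u₁`, `u₂` are functions of `(x, y, s)`. Either `y` is itself a component of the output, and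
then `c = 0`, or it is the time derivative of a component `c(x)`; `h` is the other component. The
last condition says that `(x, u)` is locally determined, to first order, by the derivatives of the
output up to order `r`. -/
structure IsNormalForm (r : ℕ) (O : Set (Jet 3 2 L)) (V : Jet 3 2 L → Jet 3 2 L)
    (u₁ u₂ c h : Jet 3 2 L → ℝ) : Prop extends IsJetField O V where
  lt : r < L
  nonempty : O.Nonempty
  state_eq : ∀ ζ ∈ O, (V ζ).1 = ![u₁ ζ, u₂ ζ, ζ.1 0 + u₂ ζ ^ 2 / (2 * u₁ ζ)]
  smooth_u₁ : ContDiffOn ℝ ∞ u₁ O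
  smooth_u₂ : ContDiffOn ℝ ∞ u₂ O
  u₁_ne : ∀ ζ ∈ O, u₁ ζ ≠ 0
  order_u₁ : OrderLT O 1 u₁
  order_u₂ : OrderLT O 1 u₂
  regular : ∀ ζ ∈ O, ∀ v, fderiv ℝ u₁ ζ (inputDir 3 L 0 v) = 0 →
    fderiv ℝ u₂ ζ (inputDir 3 L 0 v) = 0 → v = 0
  smooth_c : ContDiffOn ℝ ∞ c O
  smooth_h : ContDiffOn ℝ ∞ h O
  order_c : OrderLT O 0 c
  order_h : OrderLT O 1 h
  eq_zero_or_lieD_eq : (∀ ζ ∈ O, c ζ = 0) ∨ ∀ ζ ∈ O, lieD V c ζ = ζ.2 0 0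
  determined : ∀ ζ ∈ O, ∀ δ : Jet 3 2 L, fderiv ℝ c ζ δ = 0 → (∀ l, δ.2 l 0 = 0) →
    (∀ i ≤ r, fderiv ℝ ((lieD V)^[i] h) ζ δ = 0) → δ.1 = 0 ∧ δ.2 0 = 0

/-- The direction of the `l`-th derivative of the first input. -/
abbrev yDir (L l : ℕ) : Jet 3 2 L := inputDir 3 L l (Pi.single 0 1)

/-- The direction of the `l`-th derivative of the second input. -/
abbrev sDir (L l : ℕ) : Jet 3 2 L := inputDir 3 L l (Pi.single 1 1)

/-- The direction of the `k`-th state. -/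
abbrev xDir (L : ℕ) (k : Fin 3) : Jet 3 2 L := stateDir 2 L (Pi.single k 1)

namespace IsNormalForm

variable {r j : ℕ} {O : Set (Jet 3 2 L)} {V : Jet 3 2 L → Jet 3 2 L}
  {u₁ u₂ c h : Jet 3 2 L → ℝ} {ζ : Jet 3 2 L}

theorem exists_first_order (H : IsNormalForm r O V u₁ u₂ c h) :
    ∃ j ≤ r, (∃ ζ ∈ O, fderiv ℝ ((lieD V)^[j] h) ζ (sDir L 0) ≠ 0) ∧
      ∀ i < j, ∀ ζ ∈ O, fderiv ℝ ((lieD V)^[i] h) ζ (sDir L 0) = 0 := by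
  classical
  have hex : ∃ j, j ≤ r ∧ ∃ ζ ∈ O, fderiv ℝ ((lieD V)^[j] h) ζ (sDir L 0) ≠ 0 := by
    by_contra! hcon
    obtain ⟨ζ, hζ⟩ := H.nonempty
    have := (H.determined ζ hζ (sDir L 0) (H.order_c ζ hζ 0 le_rfl _)
      (fun l => by by_cases hl : l = 0 <;> simp [inputDir, hl])
      fun i hi => hcon i hi ζ hζ).2
    simpa [inputDir] using congrFun this 1
  refine ⟨Nat.find hex, (Nat.find_spec hex).1, (Nat.find_spec hex).2, fun i hi ζ hζ => ?_⟩
  have := Nat.find_min hex hi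
  push Not at this
  exact this (hi.le.trans (Nat.find_spec hex).1) ζ hζ

theorem contDiffOn_iter (H : IsNormalForm r O V u₁ u₂ c h) (i : ℕ) :
    ContDiffOn ℝ ∞ ((lieD V)^[i] h) O := H.contDiffOn_iterate H.smooth_h i

theorem orderLT_iter (H : IsNormalForm r O V u₁ u₂ c h) {i : ℕ} (hi : i < L) :
    OrderLT O L ((lieD V)^[i] h) :=
  (H.orderLT_iterate H.smooth_h H.order_h i (by omega)).mono (by omega)

theorem fderiv_iter_sDir_of_lt (H : IsNormalForm r O V u₁ u₂ c h) (hj : j ≤ r)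
    (hmin : ∀ i < j, ∀ ζ ∈ O, fderiv ℝ ((lieD V)^[i] h) ζ (sDir L 0) = 0) {i : ℕ} (hi : i < j)
    (l : ℕ) : ∀ ζ ∈ O, fderiv ℝ ((lieD V)^[i] h) ζ (sDir L l) = 0 := by
  induction i generalizing l with
  | zero =>
    rcases l with _ | l
    · exact hmin 0 hi
    · exact fun ζ hζ => H.order_h ζ hζ _ (by omega) _
  | succ i ih =>
    rcases l with _ | l
    · exact hmin _ hi
    · intro ζ hζ
      have := H.lt
      rw [Function.iterate_succ_apply', H.fderiv_lieD_inputDir_succ (H.contDiffOn_iter i)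
        (H.orderLT_iter (by omega)) hζ, ih (by omega) l ζ hζ,
        lieD_eq_zero_of_eqOn_const H.isOpen (ih (by omega) (l + 1)) hζ, add_zero]

theorem fderiv_iter_add_sDir (H : IsNormalForm r O V u₁ u₂ c h) (hj : j ≤ r)
    (hmin : ∀ i < j, ∀ ζ ∈ O, fderiv ℝ ((lieD V)^[i] h) ζ (sDir L 0) = 0) (m : ℕ)
    (hm : j + m ≤ r) : ∀ ζ ∈ O,
      (∀ l, m < l → fderiv ℝ ((lieD V)^[j + m] h) ζ (sDir L l) = 0) ∧
      fderiv ℝ ((lieD V)^[j + m] h) ζ (sDir L m) = fderiv ℝ ((lieD V)^[j] h) ζ (sDir L 0) := by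
  have := H.lt
  induction m with
  | zero =>
    intro ζ hζ
    refine ⟨fun l hl => ?_, rfl⟩
    rcases j with _ | j
    · exact H.order_h ζ hζ l (by omega) _
    · obtain ⟨l, rfl⟩ : ∃ k, l = k + 1 := ⟨l - 1, by omega⟩
      have hlt := H.fderiv_iter_sDir_of_lt hj hmin (Nat.lt_succ_self j)
      rw [add_zero, Function.iterate_succ_apply', H.fderiv_lieD_inputDir_succ
        (H.contDiffOn_iter j) (H.orderLT_iter (by omega)) hζ, hlt l ζ hζ,
        lieD_eq_zero_of_eqOn_const H.isOpen (hlt (l + 1)) hζ, add_zero]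
  | succ m ih =>
    intro ζ hζ
    have ih := ih (by omega)
    have key : ∀ l, m < l → fderiv ℝ ((lieD V)^[j + (m + 1)] h) ζ (sDir L l) =
        fderiv ℝ ((lieD V)^[j + m] h) ζ (sDir L (l - 1)) := fun l hl => by
      obtain ⟨l, rfl⟩ : ∃ k, l = k + 1 := ⟨l - 1, by omega⟩
      rw [← add_assoc, Function.iterate_succ_apply', H.fderiv_lieD_inputDir_succ
        (H.contDiffOn_iter _) (H.orderLT_iter (by omega)) hζ,
        lieD_eq_zero_of_eqOn_const H.isOpen (fun ζ hζ => (ih ζ hζ).1 _ hl) hζ, zero_add]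
      rfl
    refine ⟨fun l hl => ?_, ?_⟩
    · rw [key l (by omega), (ih ζ hζ).1 _ (by omega)]
    · rw [key _ (by omega), ← (ih ζ hζ).2]; rfl

/-- Where `h^(j)` is the first derivative of `h` that depends on `s`, the state is determined, to
first order, by `c` and the derivatives of `h` of order less than `j`: a variation of the state that
annihilates these can be completed, by choosing the variations of `s` and its
derivatives recursively, to one that annihilates the higher derivatives of `h` as well. -/
theorem eq_zero_of_fderiv_stateDir_eq_zero (H : IsNormalForm r O V u₁ u₂ c h) (hj : j ≤ r)
    (hmin : ∀ i < j, ∀ ζ ∈ O, fderiv ℝ ((lieD V)^[i] h) ζ (sDir L 0) = 0) (hζ : ζ ∈ O)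
    (hne : fderiv ℝ ((lieD V)^[j] h) ζ (sDir L 0) ≠ 0) {e : Fin 3 → ℝ}
    (hc : fderiv ℝ c ζ (stateDir 2 L e) = 0)
    (hh : ∀ i < j, fderiv ℝ ((lieD V)^[i] h) ζ (stateDir 2 L e) = 0) : e = 0 := by
  have hrL := H.lt
  obtain ⟨s, hs⟩ := exists_solution_of_lowerTriangular
    (fun m l => fderiv ℝ ((lieD V)^[j + m] h) ζ (sDir L l))
    (fun m => fderiv ℝ ((lieD V)^[j + m] h) ζ (stateDir 2 L e)) (r + 1 - j)
    (fun m hm => by rw [(H.fderiv_iter_add_sDir hj hmin m (by omega) ζ hζ).2]; exact hne)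
    (fun m hm l hl => (H.fderiv_iter_add_sDir hj hmin m (by omega) ζ hζ).1 l hl)
  set δ : Jet 3 2 L := stateDir 2 L e + ∑ l ∈ Finset.range (r + 1 - j), s l • sDir L l with hδ
  have hmap (T : Jet 3 2 L →L[ℝ] ℝ) : T δ =
      T (stateDir 2 L e) + ∑ l ∈ Finset.range (r + 1 - j), T (sDir L l) * s l := by
    simp only [hδ, map_add, map_sum, map_smul, smul_eq_mul, mul_comm]
  have hres := H.determined ζ hζ δ ?_ (fun l => ?_) fun i hi => ?_
  · have := hres.1
    simpa [hδ, stateDir, inputDir, Prod.fst_sum] using this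
  · rw [hmap, hc, Finset.sum_eq_zero, zero_add]
    intro l _
    rw [H.order_c ζ hζ l (by omega), zero_mul]
  · simp only [hδ, stateDir, Prod.snd_add, Prod.snd_sum, Prod.smul_snd, Pi.add_apply,
      Finset.sum_apply, Pi.smul_apply, inputDir]
    simp only [Pi.zero_apply, zero_add]
    refine Finset.sum_eq_zero fun i _ => ?_
    split_ifs <;> simp
  · rw [hmap]
    rcases lt_or_ge i j with hij | hij
    · rw [hh i hij, Finset.sum_eq_zero, zero_add]
      intro l _
      rw [H.fderiv_iter_sDir_of_lt hj hmin hij l ζ hζ, zero_mul]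
    · obtain ⟨m, rfl⟩ := Nat.exists_eq_add_of_le hij
      exact hs m (by omega)

end IsNormalForm

end NormalForm

/-! ### The cone of velocities -/

section Cone

variable {L : ℕ}

theorem fderiv_fderiv_stateDir {n m : ℕ} {O : Set (Jet n m L)} (hO : IsOpen O)
    {b : Jet n m L → Fin n → ℝ} {h : Jet n m L → ℝ} (hb : ContDiffOn ℝ ∞ b O)
    (hh : ContDiffOn ℝ ∞ h O) (hzero : ∀ ζ ∈ O, fderiv ℝ h ζ (stateDir m L (b ζ)) = 0)
    {ζ : Jet n m L} (hζ : ζ ∈ O) (e : Jet n m L) :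
    fderiv ℝ (fun ζ => fderiv ℝ h ζ e) ζ (stateDir m L (b ζ)) +
      fderiv ℝ h ζ (stateDir m L (fderiv ℝ b ζ e)) = 0 := by
  have hW : ContDiffOn ℝ ∞ (fun ζ => stateDir m L (b ζ)) O := hb.prodMk contDiffOn_const
  have h1 := fderiv_lieD_apply hO hW hh hζ e
  have h2 : fderiv ℝ (fun ζ => stateDir m L (b ζ)) ζ e = stateDir m L (fderiv ℝ b ζ e) := by
    have := ((hb.differentiableAt_of_isOpen hO hζ).hasFDerivAt.prodMk
      (hasFDerivAt_const (0 : Fin (L + 1) → Fin m → ℝ) ζ)).fderiv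
    exact congrArg (fun T => T e) this
  have h3 : fderiv ℝ (lieD (fun ζ => stateDir m L (b ζ)) h) ζ = 0 :=
    fderiv_eq_zero_of_eqOn_const hO hzero hζ
  rw [h2, h3] at h1
  exact h1.symm

theorem fderiv_component {n m : ℕ} {O : Set (Jet n m L)} {V : Jet n m L → Jet n m L}
    (hV : IsJetField O V) {ζ : Jet n m L} (hζ : ζ ∈ O) (e : Jet n m L) (k : Fin n) :
    fderiv ℝ (fun ζ => (V ζ).1 k) ζ e = (fderiv ℝ V ζ e).1 k := by
  have h1 := (hV.smooth.differentiableAt_of_isOpen hV.isOpen hζ).hasFDerivAt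
  have h2 := (((ContinuousLinearMap.proj (R := ℝ) k).comp
    (ContinuousLinearMap.fst ℝ (Fin n → ℝ) (Fin (L + 1) → Fin m → ℝ))).hasFDerivAt.comp ζ h1).fderiv
  exact congrArg (fun T => T e) h2

theorem fderiv_state_apply {n m : ℕ} (ζ δ : Jet n m L) (k : Fin n) :
    fderiv ℝ (fun ζ : Jet n m L => ζ.1 k) ζ δ = δ.1 k :=
  congrArg (fun T => T δ) (hasFDerivAt_state ζ k).fderiv

theorem fderiv_input_apply {n m : ℕ} (ζ δ : Jet n m L) (i : Fin (L + 1)) (a : Fin m) :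
    fderiv ℝ (fun ζ : Jet n m L => ζ.2 i a) ζ δ = δ.2 i a :=
  congrArg (fun T => T δ) (hasFDerivAt_input ζ i a).fderiv

/-- The vector `2 u₁² (1, p, p² / 2)` with `p = u₂ / u₁`, which spans the ruling through
`(u₁, u₂, u₂² / (2 u₁))` of the quadratic cone `2 z₁ z₃ = z₂²` of velocities. -/
def ruling (u₁ u₂ : Jet 3 2 L → ℝ) (ζ : Jet 3 2 L) : Fin 3 → ℝ :=
  ![2 * u₁ ζ ^ 2, 2 * u₁ ζ * u₂ ζ, u₂ ζ ^ 2]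

/-- The derivative of the right-hand side with respect to the second input `s`. -/
def sVelocity (V : Jet 3 2 L → Jet 3 2 L) (ζ : Jet 3 2 L) : Fin 3 → ℝ :=
  (fderiv ℝ V ζ (sDir L 0)).1

namespace IsNormalForm

variable {r j : ℕ} {O : Set (Jet 3 2 L)} {V : Jet 3 2 L → Jet 3 2 L}
  {u₁ u₂ c h : Jet 3 2 L → ℝ} {ζ : Jet 3 2 L}

theorem contDiffOn_sVelocity (H : IsNormalForm r O V u₁ u₂ c h) :
    ContDiffOn ℝ ∞ (sVelocity V) O :=
  ContDiffOn.fst ((H.smooth.fderiv_of_isOpen H.isOpen (by simp)).clm_apply contDiffOn_const)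

theorem contDiffOn_ruling (H : IsNormalForm r O V u₁ u₂ c h) :
    ContDiffOn ℝ ∞ (ruling u₁ u₂) O := by
  rw [contDiffOn_pi]
  have h1 := H.smooth_u₁
  have h2 := H.smooth_u₂
  intro i
  fin_cases i
  · exact contDiffOn_const.mul (h1.pow 2)
  · exact (contDiffOn_const.mul h1).mul h2
  · exact h2.pow 2

theorem fderiv_ruling (H : IsNormalForm r O V u₁ u₂ c h) (hζ : ζ ∈ O) (e : Jet 3 2 L) :
    fderiv ℝ (ruling u₁ u₂) ζ e = ![4 * u₁ ζ * fderiv ℝ u₁ ζ e,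
      2 * (fderiv ℝ u₁ ζ e * u₂ ζ + u₁ ζ * fderiv ℝ u₂ ζ e), 2 * u₂ ζ * fderiv ℝ u₂ ζ e] := by
  have h1 := (H.smooth_u₁.differentiableAt_of_isOpen H.isOpen hζ).hasFDerivAt
  have h2 := (H.smooth_u₂.differentiableAt_of_isOpen H.isOpen hζ).hasFDerivAt
  ext i
  have h0 : fderiv ℝ (ruling u₁ u₂) ζ e i = fderiv ℝ (fun ζ => ruling u₁ u₂ ζ i) ζ e := by
    rw [fderiv_apply (H.contDiffOn_ruling.differentiableAt_of_isOpen H.isOpen hζ)]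
    rfl
  rw [h0]
  fin_cases i
  · refine (congrArg (fun T => T e) ((h1.pow 2).const_mul 2).fderiv).trans ?_
    simp; ring
  · refine (congrArg (fun T => T e) ((h1.const_mul 2).mul h2).fderiv).trans ?_
    simp; ring
  · refine (congrArg (fun T => T e) (h2.pow 2).fderiv).trans ?_
    simp

theorem fderiv_iter_sVelocity (H : IsNormalForm r O V u₁ u₂ c h) {i : ℕ} (hi : i < L)
    (hmin : ∀ ζ ∈ O, fderiv ℝ ((lieD V)^[i] h) ζ (sDir L 0) = 0) (hζ : ζ ∈ O) :
    fderiv ℝ ((lieD V)^[i] h) ζ (stateDir 2 L (sVelocity V ζ)) =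
      fderiv ℝ ((lieD V)^[i + 1] h) ζ (sDir L 0) := by
  rw [Function.iterate_succ_apply', H.fderiv_lieD_inputDir_zero (H.contDiffOn_iter i)
    (H.orderLT_iter hi) hζ, lieD_eq_zero_of_eqOn_const H.isOpen hmin hζ, zero_add]
  rfl

theorem fderiv_c_sVelocity (H : IsNormalForm r O V u₁ u₂ c h) (hζ : ζ ∈ O) :
    fderiv ℝ c ζ (stateDir 2 L (sVelocity V ζ)) = 0 := by
  rcases H.eq_zero_or_lieD_eq with hc | hc
  · rw [fderiv_eq_zero_of_eqOn_const H.isOpen hc hζ]; rfl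
  · have h1 := H.fderiv_lieD_inputDir_zero H.smooth_c (H.order_c.mono (Nat.zero_le _)) hζ
      (Pi.single 1 1)
    rw [lieD_eq_zero_of_eqOn_const H.isOpen (fun ζ hζ => H.order_c ζ hζ 0 le_rfl _) hζ,
      Set.EqOn.fderiv_eq_of_isOpen (f₂ := fun ζ : Jet 3 2 L => ζ.2 0 0) hc H.isOpen hζ,
      fderiv_input_apply, zero_add] at h1
    rw [sVelocity, sDir, ← h1]
    simp [inputDir]

/-- The velocity `∂f/∂s` lies in the common kernel of the differentials, with respect to the state,
of `c` and of `h^(i)`, `i + 1 < j`; this kernel is a line and does not depend on `s`. -/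
theorem exists_fderiv_sVelocity_eq_smul (H : IsNormalForm r O V u₁ u₂ c h) (hj : j ≤ r)
    (hmin : ∀ i < j, ∀ ζ ∈ O, fderiv ℝ ((lieD V)^[i] h) ζ (sDir L 0) = 0) (hζ : ζ ∈ O)
    (hne : fderiv ℝ ((lieD V)^[j] h) ζ (sDir L 0) ≠ 0) :
    sVelocity V ζ ≠ 0 ∧ ∃ a : ℝ, fderiv ℝ (sVelocity V) ζ (sDir L 0) = a • sVelocity V ζ := by
  have hrL := H.lt
  have hj0 : j ≠ 0 := by
    rintro rfl
    obtain ⟨e, he, hce, -⟩ := exists_ne_zero_stateDir_of_two (fderiv ℝ c ζ) (fderiv ℝ c ζ)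
    exact he (H.eq_zero_of_fderiv_stateDir_eq_zero hj hmin hζ hne hce (by simp))
  obtain ⟨j, rfl⟩ := Nat.exists_eq_succ_of_ne_zero hj0
  have hN := H.fderiv_iter_sVelocity (by omega) (hmin j (by omega)) hζ
  refine ⟨fun h0 => hne ?_, ?_⟩
  · rw [Nat.succ_eq_add_one, ← hN, h0]
    exact map_zero _
  set N' := fderiv ℝ (sVelocity V) ζ (sDir L 0)
  rw [Nat.succ_eq_add_one, ← hN] at hne
  set a := fderiv ℝ ((lieD V)^[j] h) ζ (stateDir 2 L N') /
    fderiv ℝ ((lieD V)^[j] h) ζ (stateDir 2 L (sVelocity V ζ)) with ha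
  refine ⟨a, sub_eq_zero.1 (H.eq_zero_of_fderiv_stateDir_eq_zero hj hmin hζ (hN ▸ hne) ?_ ?_)⟩
  all_goals
    have hsub : stateDir 2 L (N' - a • sVelocity V ζ) =
      stateDir 2 L N' - a • stateDir 2 L (sVelocity V ζ) := by simp [stateDir]
    simp only [hsub, map_sub, map_smul, smul_eq_mul]
  · have := fderiv_fderiv_stateDir H.isOpen H.contDiffOn_sVelocity H.smooth_c
      (fun ζ hζ => H.fderiv_c_sVelocity hζ) hζ (sDir L 0)
    rw [fderiv_eq_zero_of_eqOn_const H.isOpen (fun ζ hζ => H.order_c ζ hζ 0 le_rfl _) hζ,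
      zero_apply, zero_add] at this
    rw [H.fderiv_c_sVelocity hζ, this]; simp
  · intro i hi
    rcases Nat.lt_succ_iff_lt_or_eq.1 hi with hij | rfl
    · have h0 : ∀ ζ ∈ O, fderiv ℝ ((lieD V)^[i] h) ζ (stateDir 2 L (sVelocity V ζ)) = 0 :=
        fun ζ hζ => by
          rw [H.fderiv_iter_sVelocity (by omega) (hmin i hi) hζ]
          exact hmin (i + 1) (by omega) ζ hζ
      have := fderiv_fderiv_stateDir H.isOpen H.contDiffOn_sVelocity (H.contDiffOn_iter i)
        h0 hζ (sDir L 0)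
      rw [fderiv_eq_zero_of_eqOn_const H.isOpen (hmin i hi) hζ,
        zero_apply, zero_add] at this
      rw [h0 ζ hζ, this]; simp
    · rw [ha, div_mul_cancel₀ _ hne, sub_self]

/-- A velocity `∂f/∂s` of fixed direction is parallel to a ruling: differentiate twice the
equation `2 z₁ z₃ = z₂²` of the cone, on which `(ẋ₁, ẋ₂, ẋ₃ - x₁)` lies. -/
theorem exists_ruling_eq_smul (H : IsNormalForm r O V u₁ u₂ c h) (hζ : ζ ∈ O)
    (hN : sVelocity V ζ ≠ 0) {a : ℝ}
    (ha : fderiv ℝ (sVelocity V) ζ (sDir L 0) = a • sVelocity V ζ) :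
    ∃ b : ℝ, ruling u₁ u₂ ζ = b • sVelocity V ζ := by
  have hf (k : Fin 3) : ContDiffOn ℝ ∞ (fun ζ => (V ζ).1 k) O :=
    contDiffOn_pi.1 (ContDiffOn.fst H.smooth) k
  have hd (k : Fin 3) {ζ : Jet 3 2 L} (hζ : ζ ∈ O) :=
    ((hf k).differentiableAt_of_isOpen H.isOpen hζ).hasFDerivAt
  have hNs (k : Fin 3) : ContDiffOn ℝ ∞ (fun ζ => sVelocity V ζ k) O :=
    contDiffOn_pi.1 H.contDiffOn_sVelocity k
  have hNd (k : Fin 3) := ((hNs k).differentiableAt_of_isOpen H.isOpen hζ).hasFDerivAt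
  have hN1 (k : Fin 3) {ζ : Jet 3 2 L} (hζ : ζ ∈ O) :
      fderiv ℝ (fun ζ => (V ζ).1 k) ζ (sDir L 0) = sVelocity V ζ k :=
    fderiv_component H.toIsJetField hζ _ k
  have hN2 (k : Fin 3) : fderiv ℝ (fun ζ => sVelocity V ζ k) ζ (sDir L 0) =
      a * sVelocity V ζ k := by
    have := congrFun ha k
    rw [Pi.smul_apply, smul_eq_mul] at this
    rw [← this, fderiv_apply (H.contDiffOn_sVelocity.differentiableAt_of_isOpen H.isOpen hζ)]
    rfl
  have hx (ζ : Jet 3 2 L) := hasFDerivAt_state ζ 0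
  -- the equation of the cone and its derivative
  have cone : ∀ ζ ∈ O, 2 * (V ζ).1 0 * ((V ζ).1 2 - ζ.1 0) - (V ζ).1 1 ^ 2 = 0 := fun ζ hζ => by
    have := H.u₁_ne ζ hζ
    rw [H.state_eq ζ hζ]
    simp
    field_simp
    ring
  have cone' : ∀ ζ ∈ O, sVelocity V ζ 0 * ((V ζ).1 2 - ζ.1 0) + (V ζ).1 0 * sVelocity V ζ 2
      - (V ζ).1 1 * sVelocity V ζ 1 = 0 := fun ζ hζ => by
    have h1 := congrArg (fun T => T (sDir L 0)) ((((hd 0 hζ).const_mul 2).mul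
      ((hd 2 hζ).sub (hx ζ))).sub ((hd 1 hζ).pow 2)).fderiv
    have h2 := congrArg (fun T => T (sDir L 0)) (fderiv_eq_zero_of_eqOn_const H.isOpen cone hζ)
    have h3 := h1.symm.trans h2
    simp [hN1 _ hζ] at h3
    simp [inputDir] at h3
    linarith
  have h1 := congrArg (fun T => T (sDir L 0)) ((((hNd 0).mul
      ((hd 2 hζ).sub (hx ζ))).add ((hd 0 hζ).mul (hNd 2))).sub ((hd 1 hζ).mul (hNd 1))).fderiv
  have h2 := congrArg (fun T => T (sDir L 0)) (fderiv_eq_zero_of_eqOn_const H.isOpen cone' hζ)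
  have h3 := h1.symm.trans h2
  simp [hN1 _ hζ, hN2] at h3
  simp [inputDir] at h3
  have hu := H.u₁_ne ζ hζ
  have h4 := cone ζ hζ
  have h5 := cone' ζ hζ
  have e0 : (V ζ).1 0 = u₁ ζ := by rw [H.state_eq ζ hζ]; rfl
  have e1 : (V ζ).1 1 = u₂ ζ := by rw [H.state_eq ζ hζ]; rfl
  rw [e0, e1] at h3 h4 h5
  set q := (V ζ).1 2 - ζ.1 0
  set N0 := sVelocity V ζ 0
  set N1 := sVelocity V ζ 1
  set N2 := sVelocity V ζ 2
  have h6 : 2 * N0 * N2 = N1 ^ 2 := by linear_combination h3 - a * h5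
  have h7 : u₁ ζ * N1 = u₂ ζ * N0 := by
    have : (u₁ ζ * N1 - u₂ ζ * N0) ^ 2 = 0 := by
      linear_combination 2 * u₁ ζ * N0 * h5 - u₁ ζ ^ 2 * h6 - N0 ^ 2 * h4
    linarith [pow_eq_zero_iff (two_ne_zero) |>.1 this]
  have h8 : 2 * u₁ ζ ^ 2 * N2 = u₂ ζ ^ 2 * N0 := by
    linear_combination 2 * u₁ ζ * h5 - N0 * h4 + 2 * u₂ ζ * h7
  have h9 : N0 ≠ 0 := fun h0 => hN <| by
    rw [h0, mul_zero] at h7 h8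
    have a1 : N1 = 0 := by simpa [hu] using h7
    have a2 : N2 = 0 := by simpa [hu] using h8
    ext k
    fin_cases k
    · exact h0
    · exact a1
    · exact a2
  refine ⟨2 * u₁ ζ ^ 2 / N0, ?_⟩
  ext k
  fin_cases k
  · show 2 * u₁ ζ ^ 2 = _ / N0 * N0
    field_simp
  · show 2 * u₁ ζ * u₂ ζ = _ / N0 * N1
    field_simp
    linear_combination -h7
  · show u₂ ζ ^ 2 = _ / N0 * N2
    field_simp
    linear_combination -h8

end IsNormalForm

end Cone

/-! ### The normal form is contradictory -/

section Contradiction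

variable {L : ℕ}

namespace IsNormalForm

variable {r : ℕ} {O O₁ : Set (Jet 3 2 L)} {V : Jet 3 2 L → Jet 3 2 L}
  {u₁ u₂ c h : Jet 3 2 L → ℝ} {ζ : Jet 3 2 L}

/-- If the differential of `g(x, y)` annihilates the rulings, then the time derivative of `g` with
`y` frozen involves only the derivative of `g` with respect to the third state. -/
theorem fderiv_stateDir_state (H : IsNormalForm r O V u₁ u₂ c h) (hζ : ζ ∈ O)
    {g : Jet 3 2 L → ℝ} (hg : fderiv ℝ g ζ (stateDir 2 L (ruling u₁ u₂ ζ)) = 0) :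
    fderiv ℝ g ζ (stateDir 2 L (V ζ).1) = ζ.1 0 * fderiv ℝ g ζ (xDir L 2) := by
  have hu := H.u₁_ne ζ hζ
  rw [map_stateDir_three] at hg ⊢
  rw [H.state_eq ζ hζ]
  simp only [ruling, Matrix.cons_val_zero, Matrix.cons_val_one, Matrix.cons_val] at hg ⊢
  field_simp
  linear_combination hg

/-- If the differential of `c(x)` annihilates the rulings, then `ċ` is a function of `x` alone, and
cannot be the input `y`. -/
theorem false_of_lieD_eq (H : IsNormalForm r O V u₁ u₂ c h) (hO₁ : IsOpen O₁) (hsub : O₁ ⊆ O)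
    (hζ : ζ ∈ O₁) (hc : ∀ ζ ∈ O₁, fderiv ℝ c ζ (stateDir 2 L (ruling u₁ u₂ ζ)) = 0)
    (hy : ∀ ζ ∈ O, lieD V c ζ = ζ.2 0 0) : False := by
  have hy' : Set.EqOn (fun ζ : Jet 3 2 L => ζ.2 0 0)
      (fun ζ => ζ.1 0 * fderiv ℝ c ζ (xDir L 2)) O₁ := fun ζ hζ => by
    have h1 := H.fderiv_stateDir_state (hsub hζ) (hc ζ hζ)
    have h2 := fderiv_eq_add_of_orderLT_one (H.order_c.mono zero_le_one) (hsub hζ) (V ζ)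
    rw [H.order_c ζ (hsub hζ) 0 le_rfl, add_zero, h1] at h2
    exact (hy ζ (hsub hζ)).symm.trans h2
  have hx := hasFDerivAt_state ζ 0
  have hc3 := ((H.smooth_c.fderiv_apply_const H.isOpen (xDir L 2)).differentiableAt_of_isOpen
    H.isOpen (hsub hζ)).hasFDerivAt
  have h1 := congrArg (fun T => T (yDir L 0)) (hy'.fderiv_eq_of_isOpen hO₁ hζ)
  have h2 := congrArg (fun T => T (yDir L 0)) (hx.mul hc3).fderiv
  have h3 := h1.trans h2
  have h4 := fderiv_fderiv_comm H.isOpen H.smooth_c (hsub hζ) (yDir L 0) (xDir L 2)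
  rw [fderiv_eq_zero_of_eqOn_const H.isOpen
    (fun ζ hζ => H.order_c ζ hζ 0 le_rfl _) (hsub hζ)] at h4
  simp only [fderiv_input_apply] at h3
  simp [h4] at h3
  simp [inputDir] at h3

/-- If the differentials, with respect to the state, of `h(x, y)` and of `ḣ` annihilate the rulings,
then `h` is a function of `y` alone. -/
theorem fderiv_stateDir_eq_zero (H : IsNormalForm r O V u₁ u₂ c h) (hO₁ : IsOpen O₁) (hsub : O₁ ⊆ O)
    (hL : 1 < L) (hs : ∀ ζ ∈ O, fderiv ℝ h ζ (sDir L 0) = 0)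
    (h0 : ∀ ζ ∈ O₁, fderiv ℝ h ζ (stateDir 2 L (ruling u₁ u₂ ζ)) = 0)
    (h1 : ∀ ζ ∈ O₁, fderiv ℝ (lieD V h) ζ (stateDir 2 L (ruling u₁ u₂ ζ)) = 0) :
    ∀ ζ ∈ O₁, ∀ e, fderiv ℝ h ζ (stateDir 2 L e) = 0 := by
  have hw := H.contDiffOn_ruling.mono hsub
  have hh := H.smooth_h.mono hsub
  have hh1 := (ContDiffOn.lieD H.isOpen H.smooth H.smooth_h).mono hsub
  intro ζ hζ e
  have hu := H.u₁_ne ζ (hsub hζ)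
  -- the mixed derivative in `x` and `y` annihilates the ruling: it is the part of `dḣ` along `ẏ`
  have hy : fderiv ℝ (fun ζ => fderiv ℝ h ζ (yDir L 0)) ζ (stateDir 2 L (ruling u₁ u₂ ζ)) = 0 := by
    have h2 := fderiv_fderiv_stateDir hO₁ hw hh1 h1 hζ (yDir L 1)
    have h3 : Set.EqOn (fun ζ => fderiv ℝ (lieD V h) ζ (yDir L 1))
        (fun ζ => fderiv ℝ h ζ (yDir L 0)) O₁ := fun ζ hζ =>
      H.fderiv_iterate_inputDir H.smooth_h H.order_h 1 (by omega) (hsub hζ) _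
    rw [h3.fderiv_eq_of_isOpen hO₁ hζ, H.fderiv_ruling (hsub hζ),
      H.order_u₁ ζ (hsub hζ) 1 le_rfl, H.order_u₂ ζ (hsub hζ) 1 le_rfl] at h2
    rw [← h2, left_eq_add, map_stateDir_three]
    simp
  set a := fun k : Fin 3 => fderiv ℝ h ζ (xDir L k) with ha
  have e0 : 2 * u₁ ζ ^ 2 * a 0 + 2 * u₁ ζ * u₂ ζ * a 1 + u₂ ζ ^ 2 * a 2 = 0 := by
    rw [← h0 ζ hζ, map_stateDir_three]; rfl
  have expand (δ : Jet 3 2 L) : fderiv ℝ h ζ (stateDir 2 L (fderiv ℝ (ruling u₁ u₂) ζ δ)) =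
      4 * u₁ ζ * fderiv ℝ u₁ ζ δ * a 0 +
      2 * (fderiv ℝ u₁ ζ δ * u₂ ζ + u₁ ζ * fderiv ℝ u₂ ζ δ) * a 1 +
      2 * u₂ ζ * fderiv ℝ u₂ ζ δ * a 2 := by
    rw [map_stateDir_three, H.fderiv_ruling (hsub hζ)]; rfl
  -- the ruling turns with `y`, hence `dh` annihilates its derivative as well
  have e1 : u₁ ζ * a 1 + u₂ ζ * a 2 = 0 := by
    have key (k : Fin 2) (h2 : fderiv ℝ h ζ (stateDir 2 L (fderiv ℝ (ruling u₁ u₂) ζ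
          (inputDir 3 L 0 (Pi.single k 1)))) = 0) :
        (u₁ ζ * fderiv ℝ u₂ ζ (inputDir 3 L 0 (Pi.single k 1)) -
          u₂ ζ * fderiv ℝ u₁ ζ (inputDir 3 L 0 (Pi.single k 1))) *
          (u₁ ζ * a 1 + u₂ ζ * a 2) = 0 := by
      rw [expand] at h2
      linear_combination u₁ ζ / 2 * h2 - fderiv ℝ u₁ ζ (inputDir 3 L 0 (Pi.single k 1)) * e0
    have ky := key 0 (by
      have h2 := fderiv_fderiv_stateDir hO₁ hw hh h0 hζ (yDir L 0)
      rwa [hy, zero_add] at h2)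
    have ks := key 1 (by
      have h2 := fderiv_fderiv_stateDir hO₁ hw hh h0 hζ (sDir L 0)
      rwa [fderiv_eq_zero_of_eqOn_const hO₁ (fun ζ hζ => hs ζ (hsub hζ)) hζ, zero_apply,
        zero_add] at h2)
    by_contra hne
    have ky := (mul_eq_zero.1 ky).resolve_right hne
    have ks := (mul_eq_zero.1 ks).resolve_right hne
    set y1 := fderiv ℝ u₁ ζ (inputDir 3 L 0 (Pi.single 0 1))
    set s1 := fderiv ℝ u₁ ζ (inputDir 3 L 0 (Pi.single 1 1))
    set y2 := fderiv ℝ u₂ ζ (inputDir 3 L 0 (Pi.single 0 1))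
    set s2 := fderiv ℝ u₂ ζ (inputDir 3 L 0 (Pi.single 1 1))
    have hdet : s1 * y2 - y1 * s2 = 0 := by
      have : u₁ ζ * (s1 * y2 - y1 * s2) = 0 := by linear_combination s1 * ky - y1 * ks
      exact (mul_eq_zero.1 this).resolve_left hu
    have hreg : ∀ v : Fin 2 → ℝ, v 0 * y1 + v 1 * s1 = 0 → v 0 * y2 + v 1 * s2 = 0 → v = 0 :=
      fun v hv1 hv2 => H.regular ζ (hsub hζ) v (by rw [map_inputDir_two, ← hv1])
        (by rw [map_inputDir_two, ← hv2])
    have h3 := hreg ![s1, -y1] (by simp; ring) (by simp; linear_combination hdet)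
    have hs1 : s1 = 0 := congrFun h3 0
    have hy1 : y1 = 0 := neg_eq_zero.1 (congrFun h3 1)
    have h4 := hreg ![s2, -y2] (by simp [hs1, hy1]) (by simp; ring)
    have hs2 : s2 = 0 := congrFun h4 0
    have h5 := hreg ![0, 1] (by simp [hs1]) (by simp [hs2])
    exact one_ne_zero (congrFun h5 1)
  -- differentiating `dh(ruling) = 0` with respect to `x₃`
  have hx : fderiv ℝ (fun ζ => fderiv ℝ h ζ (xDir L 2)) ζ (stateDir 2 L (ruling u₁ u₂ ζ)) = 0 := by
    have h2 := fderiv_fderiv_stateDir hO₁ hw hh h0 hζ (xDir L 2)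
    have h3 : fderiv ℝ h ζ (stateDir 2 L (fderiv ℝ (ruling u₁ u₂) ζ (xDir L 2))) = 0 := by
      rw [expand]
      have : u₁ ζ * (4 * u₁ ζ * fderiv ℝ u₁ ζ (xDir L 2) * a 0 +
          2 * (fderiv ℝ u₁ ζ (xDir L 2) * u₂ ζ + u₁ ζ * fderiv ℝ u₂ ζ (xDir L 2)) * a 1 +
          2 * u₂ ζ * fderiv ℝ u₂ ζ (xDir L 2) * a 2) = 0 := by
        linear_combination 2 * fderiv ℝ u₁ ζ (xDir L 2) * e0 +
          2 * (u₁ ζ * fderiv ℝ u₂ ζ (xDir L 2) - u₂ ζ * fderiv ℝ u₁ ζ (xDir L 2)) * e1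
      exact (mul_eq_zero.1 this).resolve_left hu
    rwa [h3, add_zero] at h2
  have e2 : a 2 = 0 := by
    have heq : Set.EqOn (lieD V h) (fun ζ => ζ.1 0 * fderiv ℝ h ζ (xDir L 2) +
        ζ.2 ⟨1, by omega⟩ 0 * fderiv ℝ h ζ (yDir L 0)) O₁ := fun ζ hζ => by
      have h2 := H.fderiv_stateDir_state (hsub hζ) (h0 ζ hζ)
      have h3 := fderiv_eq_add_of_orderLT_one H.order_h (hsub hζ) (V ζ)
      rw [map_inputDir_two, hs ζ (hsub hζ), h2, mul_zero, add_zero] at h3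
      have h4 := H.shift ζ (hsub hζ) ⟨0, by omega⟩
      rw [show (V ζ).2 0 = ζ.2 ⟨1, by omega⟩ from h4] at h3
      exact h3
    have d1 := hasFDerivAt_state ζ 0
    have d2 := ((hh.fderiv_apply_const hO₁ (xDir L 2)).differentiableAt_of_isOpen
      hO₁ hζ).hasFDerivAt
    have d3 := hasFDerivAt_input ζ ⟨1, by omega⟩ 0
    have d4 := ((hh.fderiv_apply_const hO₁ (yDir L 0)).differentiableAt_of_isOpen
      hO₁ hζ).hasFDerivAt
    have h2 := congrArg (fun T => T (stateDir 2 L (ruling u₁ u₂ ζ)))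
      ((d1.mul d2).add (d3.mul d4)).fderiv
    have h3 := congrArg (fun T => T (stateDir 2 L (ruling u₁ u₂ ζ)))
      (heq.fderiv_eq_of_isOpen hO₁ hζ)
    have h4 := h3.trans h2
    simp only [h1 ζ hζ] at h4
    simp [hx, hy] at h4
    simp [stateDir, ruling, hu] at h4
    exact h4
  have e3 : a 1 = 0 := by simpa [e2, hu] using e1
  have e4 : a 0 = 0 := by simpa [e2, e3, hu] using e0
  rw [map_stateDir_three]
  simp only [ha] at e2 e3 e4
  simp only [xDir] at e2 e3 e4
  rw [e2, e3, e4]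
  simp

/-- If `h` does not depend on the state, neither do its time derivatives. -/
theorem fderiv_iter_stateDir_eq_zero (H : IsNormalForm r O V u₁ u₂ c h) (hO₁ : IsOpen O₁)
    (hsub : O₁ ⊆ O) (h0 : ∀ ζ ∈ O₁, ∀ e, fderiv ℝ h ζ (stateDir 2 L e) = 0) {i : ℕ} (hi : i ≤ L) :
    ∀ ζ ∈ O₁, ∀ e, fderiv ℝ ((lieD V)^[i] h) ζ (stateDir 2 L e) = 0 := by
  induction i with
  | zero => exact h0
  | succ i ih =>
    intro ζ hζ e
    rw [Function.iterate_succ_apply', H.fderiv_lieD_stateDir (H.contDiffOn_iter i)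
      (H.orderLT_iter (by omega)) (hsub hζ), ih (by omega) ζ hζ,
      lieD_eq_zero_of_eqOn_const hO₁ (fun ζ hζ => ih (by omega) ζ hζ e) hζ, add_zero]

theorem elim (H : IsNormalForm r O V u₁ u₂ c h) : False := by
  have hrL := H.lt
  obtain ⟨j, hj, ⟨ζ, hζ, hne⟩, hmin⟩ := H.exists_first_order
  set O₁ := O ∩ {ζ | fderiv ℝ ((lieD V)^[j] h) ζ (sDir L 0) ≠ 0}
  have hO₁ : IsOpen O₁ := ((H.contDiffOn_iter j).fderiv_apply_const H.isOpen
    (sDir L 0)).continuousOn.isOpen_inter_preimage H.isOpen isOpen_ne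
  have hsub : O₁ ⊆ O := Set.inter_subset_left
  have hζ₁ : ζ ∈ O₁ := ⟨hζ, hne⟩
  have hrul : ∀ ζ ∈ O₁, ∃ b : ℝ, ruling u₁ u₂ ζ = b • sVelocity V ζ := fun ζ hζ => by
    obtain ⟨h1, a, h2⟩ := H.exists_fderiv_sVelocity_eq_smul hj hmin hζ.1 hζ.2
    exact H.exists_ruling_eq_smul hζ.1 h1 h2
  rcases H.eq_zero_or_lieD_eq with hc | hc
  · have hc0 (ζ) (hζ : ζ ∈ O) := fderiv_eq_zero_of_eqOn_const H.isOpen hc hζ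
    have h3 : 3 ≤ j := by
      by_contra! hlt
      obtain ⟨e, he, h0, h1⟩ := exists_ne_zero_stateDir_of_two (fderiv ℝ ((lieD V)^[0] h) ζ)
        (fderiv ℝ ((lieD V)^[1] h) ζ)
      refine he (H.eq_zero_of_fderiv_stateDir_eq_zero hj hmin hζ hne (by simp [hc0 ζ hζ]) ?_)
      intro i hi
      obtain rfl | rfl : i = 0 ∨ i = 1 := by omega
      · exact h0
      · exact h1
    have hann (i : ℕ) (hi : i + 1 < j) : ∀ ζ ∈ O₁,
        fderiv ℝ ((lieD V)^[i] h) ζ (stateDir 2 L (ruling u₁ u₂ ζ)) = 0 := fun ζ hζ => by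
      obtain ⟨b, hb⟩ := hrul ζ hζ
      rw [hb, stateDir_smul, map_smul, H.fderiv_iter_sVelocity (by omega)
        (hmin i (by omega)) hζ.1, hmin (i + 1) hi ζ hζ.1, smul_zero]
    have hx := H.fderiv_stateDir_eq_zero hO₁ hsub (by omega) (hmin 0 (by omega))
      (hann 0 (by omega)) (hann 1 (by omega))
    have := H.eq_zero_of_fderiv_stateDir_eq_zero hj hmin hζ hne (e := Pi.single 0 1)
      (by simp [hc0 ζ hζ]) fun i hi => H.fderiv_iter_stateDir_eq_zero hO₁ hsub hx
        (by omega) ζ hζ₁ _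
    simpa using congrFun this 0
  · refine H.false_of_lieD_eq hO₁ hsub hζ₁ (fun ζ hζ => ?_) hc
    obtain ⟨b, hb⟩ := hrul ζ hζ
    rw [hb, stateDir_smul, map_smul, H.fderiv_c_sVelocity hζ.1, smul_zero]

end IsNormalForm

end Contradiction

/-! ### Change of coordinates to the normal form -/

section CoordinateChange

variable {L : ℕ}

theorem fderiv_eq_of_orderLT_zero {n m : ℕ} {O : Set (Jet n m L)} {h : Jet n m L → ℝ}
    (hord : OrderLT O 0 h) {ζ : Jet n m L} (hζ : ζ ∈ O) (δ : Jet n m L) :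
    fderiv ℝ h ζ δ = fderiv ℝ h ζ (stateDir m L δ.1) := by
  rw [fderiv_eq_add_of_orderLT_one (hord.mono zero_le_one) hζ, hord ζ hζ 0 le_rfl, add_zero]

theorem fderiv_eq_zero_of_orderLT_one {n m : ℕ} {O : Set (Jet n m L)} {h : Jet n m L → ℝ}
    (hord : OrderLT O 1 h) {ζ : Jet n m L} (hζ : ζ ∈ O) {δ : Jet n m L} (h1 : δ.1 = 0)
    (h2 : δ.2 0 = 0) : fderiv ℝ h ζ δ = 0 := by
  rw [fderiv_eq_add_of_orderLT_one hord hζ, h1, h2,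
    show stateDir m L (0 : Fin n → ℝ) = 0 from rfl,
    show inputDir n L 0 (0 : Fin m → ℝ) = 0 by simp [inputDir]; rfl, map_zero, add_zero]

theorem IsJetField.fst_fderiv_eq_zero {n m : ℕ} {O : Set (Jet n m L)} {V : Jet n m L → Jet n m L}
    (hV : IsJetField O V) {ζ : Jet n m L} (hζ : ζ ∈ O) {δ : Jet n m L} (h1 : δ.1 = 0)
    (h2 : δ.2 0 = 0) : (fderiv ℝ V ζ δ).1 = 0 := by
  rw [← stateDir_add_sum_inputDir δ, map_add, map_sum, Fin.sum_univ_succ, h1, h2,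
    show stateDir m L (0 : Fin n → ℝ) = 0 from rfl,
    show inputDir n L (0 : Fin (L + 1)) (0 : Fin m → ℝ) = 0 by simp [inputDir]; rfl, map_zero,
    zero_add, zero_add, Prod.fst_sum]
  exact Finset.sum_eq_zero fun i _ => hV.state ζ hζ _ (by simp) _

/-- The change of coordinates that replaces `u^(i)` by `(y^(i), uₖ^(i))`. -/
def inputChange (V : Jet 3 2 L → Jet 3 2 L) (y : Jet 3 2 L → ℝ) (k : Fin 2) (ζ : Jet 3 2 L) :
    Jet 3 2 L :=
  (ζ.1, fun i => ![(lieD V)^[i] y ζ, ζ.2 i k])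

variable {O : Set (Jet 3 2 L)} {V : Jet 3 2 L → Jet 3 2 L} {y : Jet 3 2 L → ℝ} {k k' : Fin 2}
  {ζ : Jet 3 2 L}

theorem contDiffOn_inputChange (hV : IsJetField O V) (hy : ContDiffOn ℝ ∞ y O) :
    ContDiffOn ℝ ∞ (inputChange V y k) O := by
  refine ContDiffOn.prodMk contDiff_fst.contDiffOn
    (contDiffOn_pi.2 fun i => contDiffOn_pi.2 fun a => ?_)
  fin_cases a
  · exact hV.contDiffOn_iterate hy i
  · exact ContDiff.contDiffOn (f := fun ζ : Jet 3 2 L => ζ.2 i k) (by fun_prop)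

theorem fderiv_inputChange (hV : IsJetField O V) (hy : ContDiffOn ℝ ∞ y O) (hζ : ζ ∈ O)
    (δ : Jet 3 2 L) : fderiv ℝ (inputChange V y k) ζ δ =
      (δ.1, fun i : Fin (L + 1) => ![fderiv ℝ ((lieD V)^[i] y) ζ δ, δ.2 i k]) := by
  have hd := ((contDiffOn_inputChange (k := k) hV hy).differentiableAt_of_isOpen
    hV.isOpen hζ).hasFDerivAt
  refine Prod.ext ?_ (funext fun i => funext fun a => ?_)
  · exact (congrArg (fun T => T δ)
      (((ContinuousLinearMap.fst ℝ _ _).hasFDerivAt.comp ζ hd).fderiv)).symm.trans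
      (congrArg (fun T => T δ) (ContinuousLinearMap.fst ℝ (Fin 3 → ℝ) _).fderiv)
  · have h1 := congrArg (fun T => T δ) ((((ContinuousLinearMap.proj (R := ℝ) a).comp
      ((ContinuousLinearMap.proj (R := ℝ) (φ := fun _ : Fin (L + 1) => Fin 2 → ℝ) i).comp
      (ContinuousLinearMap.snd ℝ (Fin 3 → ℝ) (Fin (L + 1) → Fin 2 → ℝ)))).hasFDerivAt.comp ζ
        hd).fderiv)
    refine h1.symm.trans ?_
    fin_cases a
    · rfl
    · exact fderiv_input_apply ζ δ i k

theorem fderiv_inputChange_injective (hV : IsJetField O V) (hy : ContDiffOn ℝ ∞ y O)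
    (hord : OrderLT O 1 y) (hk : k' ≠ k) (hζ : ζ ∈ O)
    (hne : fderiv ℝ y ζ (inputDir 3 L 0 (Pi.single k' 1)) ≠ 0) :
    Function.Injective (fderiv ℝ (inputChange V y k) ζ) := by
  refine (injective_iff_map_eq_zero _).2 fun δ hδ => ?_
  rw [fderiv_inputChange hV hy hζ] at hδ
  have h1 : δ.1 = 0 := congrArg Prod.fst hδ
  have h2 (i : Fin (L + 1)) : fderiv ℝ ((lieD V)^[i] y) ζ δ = 0 :=
    congrFun (congrFun (congrArg Prod.snd hδ) i) 0
  have h3 (i : Fin (L + 1)) : δ.2 i k = 0 := congrFun (congrFun (congrArg Prod.snd hδ) i) 1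
  have h4 (i : Fin (L + 1)) : δ.2 i = δ.2 i k' • Pi.single k' 1 := by
    ext a
    rcases eq_or_ne a k' with rfl | ha
    · simp
    · obtain rfl : a = k := by omega
      simp [h3, ha]
  refine Prod.ext h1 (funext fun i => ?_)
  obtain ⟨i, hi⟩ := i
  induction i using Nat.strong_induction_on with
  | _ i ih =>
    have h5 := h2 ⟨i, hi⟩
    rw [← stateDir_add_sum_inputDir δ, h1, map_add, map_sum,
      Finset.sum_eq_single (⟨i, hi⟩ : Fin (L + 1)), h4, inputDir_smul, map_smul] at h5
    · have h6 := hV.fderiv_iterate_inputDir hy hord i (by omega) hζ (Pi.single k' 1)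
      rw [zero_add] at h6
      have h7 : stateDir 2 L (0 : Fin 3 → ℝ) = 0 := rfl
      rw [h6, h7, map_zero, zero_add, smul_eq_mul] at h5
      rw [h4, (mul_eq_zero.1 h5).resolve_right hne, zero_smul]
      rfl
    · rintro ⟨l, hl⟩ - hne
      rcases lt_or_gt_of_ne (fun h => hne (Fin.ext h) : l ≠ i) with hli | hli
      · rw [ih l hli hl]
        have : inputDir 3 L l (0 : Fin 2 → ℝ) = 0 := by simp [inputDir]; rfl
        exact (congrArg _ this).trans (map_zero _)
      · exact hV.orderLT_iterate hy hord i (by omega) ζ hζ l (by omega) _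
    · simp

/-- If a component (case `c = 0`) or the time derivative of a component `c(x)` of the output depends
on the input, then it can be made a new input, which leads to a normal form. -/
theorem false_of_determined {r : ℕ} (hr : r < L) (hV : IsJetField O V)
    (hstate : ∀ ζ ∈ O, (V ζ).1 = ![ζ.2 0 0, ζ.2 0 1, ζ.1 0 + ζ.2 0 1 ^ 2 / (2 * ζ.2 0 0)])
    (hne : ∀ ζ ∈ O, ζ.2 0 0 ≠ 0) {c h : Jet 3 2 L → ℝ} (hy : ContDiffOn ℝ ∞ y O)
    (hc : ContDiffOn ℝ ∞ c O) (hh : ContDiffOn ℝ ∞ h O) (ordy : OrderLT O 1 y)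
    (ordc : OrderLT O 0 c) (ordh : OrderLT O 1 h)
    (hor : (∀ ζ ∈ O, c ζ = 0) ∨ ∀ ζ ∈ O, lieD V c ζ = y ζ)
    (hdet : ∀ ζ ∈ O, ∀ δ : Jet 3 2 L, fderiv ℝ c ζ δ = 0 →
      (∀ i ≤ L, fderiv ℝ ((lieD V)^[i] y) ζ δ = 0) →
      (∀ i ≤ r, fderiv ℝ ((lieD V)^[i] h) ζ δ = 0) → δ.1 = 0 ∧ δ.2 0 = 0)
    {ζ₁ : Jet 3 2 L} (hζ₁ : ζ₁ ∈ O) {k' : Fin 2}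
    (hyne : fderiv ℝ y ζ₁ (inputDir 3 L 0 (Pi.single k' 1)) ≠ 0) : False := by
  obtain ⟨k, hk⟩ : ∃ k : Fin 2, k' ≠ k := ⟨k' + 1, by fin_cases k' <;> decide⟩
  set G := inputChange V y k with hG
  set O₁ := O ∩ {ζ | fderiv ℝ y ζ (inputDir 3 L 0 (Pi.single k' 1)) ≠ 0}
  have hO₁ : IsOpen O₁ := (hy.fderiv_apply_const hV.isOpen _).continuousOn.isOpen_inter_preimage
    hV.isOpen isOpen_ne
  have hsub : O₁ ⊆ O := Set.inter_subset_left
  have hGs : ContDiffOn ℝ ∞ G O := contDiffOn_inputChange hV hy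
  have hGinj (ζ) (hζ : ζ ∈ O₁) : Function.Injective (fderiv ℝ G ζ) :=
    fderiv_inputChange_injective hV hy ordy hk hζ.1 hζ.2
  have hGe (ζ) (hζ : ζ ∈ O₁) : ∃ T : Jet 3 2 L ≃L[ℝ] Jet 3 2 L,
      HasFDerivAt G (T : Jet 3 2 L →L[ℝ] Jet 3 2 L) ζ := by
    let T : Jet 3 2 L ≃L[ℝ] Jet 3 2 L := (LinearEquiv.ofInjectiveEndo
      (fderiv ℝ G ζ).toLinearMap (hGinj ζ hζ)).toContinuousLinearEquiv
    have hT : (T : Jet 3 2 L →L[ℝ] Jet 3 2 L) = fderiv ℝ G ζ := ContinuousLinearMap.ext fun _ => rfl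
    exact ⟨T, hT ▸ (hGs.differentiableAt_of_isOpen hV.isOpen hζ.1).hasFDerivAt⟩
  obtain ⟨T, hT⟩ := hGe ζ₁ ⟨hζ₁, hyne⟩
  set e := (hGs.contDiffAt (hV.isOpen.mem_nhds hζ₁)).toOpenPartialHomeomorph G hT
    (by simp)
  have heG : ⇑e = G := ContDiffAt.toOpenPartialHomeomorph_coe _ hT (by simp)
  have hsrc : ζ₁ ∈ e.source := ContDiffAt.mem_toOpenPartialHomeomorph_source _ hT (by simp)
  set g := e.symm with hg
  set O' := e.target ∩ g ⁻¹' O₁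
  have hO' : IsOpen O' := e.isOpen_inter_preimage_symm hO₁
  have hmaps : Set.MapsTo g O' O := fun ζ hζ => hsub hζ.2
  have hgs : ContDiffOn ℝ ∞ g O' := fun ζ hζ => by
    obtain ⟨T, hT⟩ := hGe (g ζ) hζ.2
    exact (e.contDiffAt_symm hζ.1 (by rw [heG]; exact hT)
      (by rw [heG]; exact hGs.contDiffAt (hV.isOpen.mem_nhds (hmaps hζ)))).contDiffWithinAt
  have hGg : Set.EqOn (fun ζ => G (g ζ)) id O' := fun ζ hζ => by
    show G (g ζ) = ζ
    rw [← heG]; exact e.right_inv hζ.1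
  have hgd {ζ} (hζ : ζ ∈ O') := (hgs.differentiableAt_of_isOpen hO' hζ).hasFDerivAt
  have hGd {ζ} (hζ : ζ ∈ O') := (hGs.differentiableAt_of_isOpen hV.isOpen (hmaps hζ)).hasFDerivAt
  have hdGg {ζ} (hζ : ζ ∈ O') (δ : Jet 3 2 L) : fderiv ℝ G (g ζ) (fderiv ℝ g ζ δ) = δ := by
    have h1 := ((hGd hζ).comp ζ (hgd hζ)).fderiv
    have h2 := hGg.fderiv_eq_of_isOpen hO' hζ
    rw [fderiv_id] at h2
    exact congrArg (fun T => T δ) (h1.symm.trans h2)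
  have hdgG {ζ} (hζ : ζ ∈ O') (δ : Jet 3 2 L) : fderiv ℝ g ζ (fderiv ℝ G (g ζ) δ) = δ :=
    hGinj _ hζ.2 (hdGg hζ _)
  set V' : Jet 3 2 L → Jet 3 2 L := fun ζ => fderiv ℝ G (g ζ) (V (g ζ)) with hV'
  -- the components of `G ∘ g = id` and of its differential
  have hcoord {ζ} (hζ : ζ ∈ O') : ζ = ((g ζ).1, fun i : Fin (L + 1) =>
      ![(lieD V)^[i] y (g ζ), (g ζ).2 i k]) := (hGg hζ).symm
  have hdcoord {ζ} (hζ : ζ ∈ O') (δ : Jet 3 2 L) : δ = ((fderiv ℝ g ζ δ).1,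
      fun i : Fin (L + 1) => ![fderiv ℝ ((lieD V)^[i] y) (g ζ) (fderiv ℝ g ζ δ),
        (fderiv ℝ g ζ δ).2 i k]) := by
    rw [← fderiv_inputChange (k := k) hV hy (hmaps hζ)]
    exact (hdGg hζ δ).symm
  have hV'eq {ζ} (hζ : ζ ∈ O') : V' ζ = ((V (g ζ)).1, fun i : Fin (L + 1) =>
      ![(lieD V)^[i + 1] y (g ζ), (V (g ζ)).2 i k]) := by
    simp only [hV', Function.iterate_succ_apply']
    exact fderiv_inputChange hV hy (hmaps hζ) _
  have hvert {ζ} (hζ : ζ ∈ O') {l : ℕ} (hl : 1 ≤ l) (v : Fin 2 → ℝ) :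
      (fderiv ℝ g ζ (inputDir 3 L l v)).1 = 0 ∧ (fderiv ℝ g ζ (inputDir 3 L l v)).2 0 = 0 := by
    have h1 := hdcoord hζ (inputDir 3 L l v)
    have h2 : (fderiv ℝ g ζ (inputDir 3 L l v)).1 = 0 := (congrArg Prod.fst h1).symm
    have h3 : (inputDir 3 L l v).2 0 = 0 := by simp [inputDir, show (0 : ℕ) ≠ l by omega]
    have h4 := congrFun (congrArg Prod.snd h1) 0
    rw [h3] at h4
    set δ := fderiv ℝ g ζ (inputDir 3 L l v)
    have h5 : fderiv ℝ y (g ζ) δ = 0 := (congrFun h4 0).symm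
    have h6 : δ.2 0 k = 0 := (congrFun h4 1).symm
    have h7 : δ.2 0 = δ.2 0 k' • Pi.single k' 1 := by
      ext a
      rcases eq_or_ne a k' with rfl | ha
      · simp
      · obtain rfl : a = k := by omega
        simp [h6, ha]
    refine ⟨h2, ?_⟩
    rw [fderiv_eq_add_of_orderLT_one ordy (hmaps hζ), h2, h7, inputDir_smul, map_smul,
      show stateDir 2 L (0 : Fin 3 → ℝ) = 0 from rfl, map_zero, zero_add] at h5
    rw [h7, (smul_eq_zero.1 h5).resolve_right hζ.2.2, zero_smul]
  have hcomp {ζ} (hζ : ζ ∈ O') {F : Jet 3 2 L → ℝ} (hF : ContDiffOn ℝ ∞ F O) (δ : Jet 3 2 L) :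
      fderiv ℝ (F ∘ g) ζ δ = fderiv ℝ F (g ζ) (fderiv ℝ g ζ δ) :=
    congrArg (fun T => T δ) ((hF.differentiableAt_of_isOpen hV.isOpen
      (hmaps hζ)).hasFDerivAt.comp ζ (hgd hζ)).fderiv
  have hlie {F : Jet 3 2 L → ℝ} (hF : ContDiffOn ℝ ∞ F O) :
      Set.EqOn (lieD V' (F ∘ g)) (lieD V F ∘ g) O' := fun ζ hζ => by
    show fderiv ℝ (F ∘ g) ζ (V' ζ) = _
    rw [hcomp hζ hF, hdgG hζ]
    rfl
  have hiter {F : Jet 3 2 L → ℝ} (hF : ContDiffOn ℝ ∞ F O) (i : ℕ) :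
      Set.EqOn ((lieD V')^[i] (F ∘ g)) ((lieD V)^[i] F ∘ g) O' := by
    induction i with
    | zero => exact fun ζ _ => rfl
    | succ i ih =>
      rw [Function.iterate_succ_apply', Function.iterate_succ_apply']
      exact (ih.lieD hO').trans (hlie (hV.contDiffOn_iterate hF i))
  have hV's : ContDiffOn ℝ ∞ V' O' :=
    ((hGs.fderiv_of_isOpen hV.isOpen (by simp)).comp hgs hmaps).clm_apply
      (hV.smooth.comp hgs hmaps)
  have hV'jet : IsJetField O' V' := by
    refine ⟨hO', hV's, fun ζ hζ l => ?_, fun ζ hζ l hl v => ?_⟩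
    · rw [hV'eq hζ]
      conv_rhs => rw [hcoord hζ]
      simp only [Fin.val_castSucc, Fin.val_succ, hV.shift _ (hmaps hζ)]
    · have h1 : Set.EqOn (fun ζ => (V' ζ).1) (fun ζ => (V (g ζ)).1) O' := fun ζ hζ => by
        simp only [hV'eq hζ]
      have h2 := h1.fderiv_eq_of_isOpen hO' hζ
      have h3 := (((ContinuousLinearMap.fst ℝ (Fin 3 → ℝ) _).hasFDerivAt.comp ζ
        (hV's.differentiableAt_of_isOpen hO' hζ).hasFDerivAt)).fderiv
      have h4 := ((ContinuousLinearMap.fst ℝ (Fin 3 → ℝ) _).hasFDerivAt.comp ζ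
        ((hV.smooth.differentiableAt_of_isOpen hV.isOpen (hmaps hζ)).hasFDerivAt.comp ζ
        (hgd hζ))).fderiv
      have h5 := congrArg (fun T => T (inputDir 3 L l v)) (h3.symm.trans (h2.trans h4))
      refine h5.trans ?_
      exact hV.fst_fderiv_eq_zero (hmaps hζ) (hvert hζ hl v).1 (hvert hζ hl v).2
  have hu (a : Fin 2) : ContDiffOn ℝ ∞ (fun ζ : Jet 3 2 L => ζ.2 0 a) O :=
    ContDiff.contDiffOn (by fun_prop)
  have hord {F : Jet 3 2 L → ℝ} (hF : ContDiffOn ℝ ∞ F O) (ordF : OrderLT O 1 F) :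
      OrderLT O' 1 (F ∘ g) := fun ζ hζ l hl v => by
    rw [hcomp hζ hF]
    exact fderiv_eq_zero_of_orderLT_one ordF (hmaps hζ) (hvert hζ hl v).1 (hvert hζ hl v).2
  have hordu (a : Fin 2) : OrderLT O 1 (fun ζ : Jet 3 2 L => ζ.2 0 a) := fun ζ hζ l hl v => by
    rw [fderiv_input_apply]; simp [inputDir, show (0 : ℕ) ≠ l by omega]
  have hzero {ζ} (hζ : ζ ∈ O') {δ : Jet 3 2 L} (h1 : (fderiv ℝ g ζ δ).1 = 0)
      (h2 : (fderiv ℝ g ζ δ).2 0 = 0) : δ.1 = 0 ∧ δ.2 0 = 0 := by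
    have h3 := hdcoord hζ δ
    refine ⟨(congrArg Prod.fst h3).trans h1, (congrFun (congrArg Prod.snd h3) 0).trans ?_⟩
    have h4 := fderiv_eq_zero_of_orderLT_one ordy (hmaps hζ) h1 h2
    ext a
    fin_cases a
    · exact h4
    · exact congrFun h2 k
  have hfst {ζ} (hζ : ζ ∈ O') (δ : Jet 3 2 L) : (fderiv ℝ g ζ δ).1 = δ.1 :=
    (congrArg Prod.fst (hdcoord hζ δ)).symm
  refine IsNormalForm.elim (r := r) (O := O') (V := V') (u₁ := (fun ζ => ζ.2 0 0) ∘ g)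
    (u₂ := (fun ζ => ζ.2 0 1) ∘ g) (c := c ∘ g) (h := h ∘ g)
    { toIsJetField := hV'jet
      lt := hr
      nonempty := ⟨e ζ₁, e.map_source hsrc, by
        show g (e ζ₁) ∈ O₁
        rw [hg, e.left_inv hsrc]; exact ⟨hζ₁, hyne⟩⟩
      state_eq := fun ζ hζ => ?_
      smooth_u₁ := (hu 0).comp hgs hmaps
      smooth_u₂ := (hu 1).comp hgs hmaps
      u₁_ne := fun ζ hζ => by exact hne _ (hmaps hζ)
      order_u₁ := hord (hu 0) (hordu 0)
      order_u₂ := hord (hu 1) (hordu 1)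
      regular := fun ζ hζ v h1 h2 => ?_
      smooth_c := hc.comp hgs hmaps
      smooth_h := hh.comp hgs hmaps
      order_c := fun ζ hζ l _ v => ?_
      order_h := hord hh ordh
      eq_zero_or_lieD_eq := ?_
      determined := fun ζ hζ δ h1 h2 h3 => ?_ }
  · have h1 : (g ζ).1 = ζ.1 := (congrArg Prod.fst (hcoord hζ)).symm
    rw [hV'eq hζ, ← h1]
    exact hstate _ (hmaps hζ)
  · rw [hcomp hζ (hu _), fderiv_input_apply] at h1 h2
    have h3 := (hzero hζ (hfst hζ (inputDir 3 L 0 v)) (by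
      ext a
      fin_cases a
      · exact h1
      · exact h2)).2
    simpa [inputDir] using h3
  · rw [hcomp hζ hc, fderiv_eq_of_orderLT_zero ordc (hmaps hζ), hfst hζ]
    exact map_zero _
  · rcases hor with h0 | h0
    · exact Or.inl fun ζ hζ => h0 _ (hmaps hζ)
    · refine Or.inr fun ζ hζ => ?_
      rw [hlie hc hζ]
      refine (h0 _ (hmaps hζ)).trans ?_
      conv_rhs => rw [hcoord hζ]
      rfl
  · rw [hcomp hζ hc] at h1
    have h4 := hdet _ (hmaps hζ) _ h1 (fun i hi => ?_) (fun i hi => ?_)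
    · exact hzero hζ h4.1 h4.2
    · have h5 := congrFun (congrFun (congrArg Prod.snd (hdcoord hζ δ)) ⟨i, by omega⟩) 0
      exact h5.symm.trans (h2 _)
    · have h5 := h3 i hi
      rwa [(hiter hh i).fderiv_eq_of_isOpen hO' hζ, hcomp hζ (hV.contDiffOn_iterate hh i)] at h5

end CoordinateChange

/-! ### Iterated time derivatives on jets of fixed order, and infinitesimal flatness -/

section Truncation

variable {n m : ℕ}

/-- The restriction `(x, u, …, u^(L)) ↦ (x, u, …, u^(k))`. -/
def jetRes (n m : ℕ) {k L : ℕ} (hk : k ≤ L) : Jet n m L →L[ℝ] Jet n m k :=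
  (ContinuousLinearMap.fst ℝ _ _).prod (ContinuousLinearMap.pi fun i =>
    (ContinuousLinearMap.proj (R := ℝ) (φ := fun _ : Fin (L + 1) => Fin m → ℝ)
      (Fin.castLE (by omega) i)).comp (ContinuousLinearMap.snd ℝ _ _))

/-- Completes a jet of order `L` by the higher derivatives of the input of `ξ₀`. -/
def jetPad (ξ₀ : InfJet n m) {L : ℕ} (ζ : Jet n m L) : InfJet n m :=
  (ζ.1, fun l => if hl : l < L + 1 then ζ.2 ⟨l, hl⟩ else ξ₀.2 l)

theorem continuous_jetPad (ξ₀ : InfJet n m) (L : ℕ) : Continuous (jetPad ξ₀ (L := L)) := by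
  refine continuous_fst.prodMk (continuous_pi fun l => ?_)
  split_ifs <;> fun_prop

theorem trunc_jetPad (ξ₀ : InfJet n m) {L : ℕ} (ζ : Jet n m L) : (jetPad ξ₀ ζ).trunc L = ζ :=
  Prod.ext rfl (funext fun i => dif_pos i.2)

theorem jetPad_trunc (ξ₀ : InfJet n m) (L : ℕ) : jetPad ξ₀ (ξ₀.trunc L) = ξ₀ :=
  Prod.ext rfl (funext fun i => by simp [InfJet.trunc, jetPad])

namespace ControlSystem

/-- The vector field `(f(x, u), u̇, …, u^(L), 0)` of the system on the jets of order `L`. -/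
def jetField (S : ControlSystem n m) (L : ℕ) (ζ : Jet n m L) : Jet n m L :=
  (S.f (ζ.1, ζ.2 0), fun i => if hi : i.val + 1 < L + 1 then ζ.2 ⟨i + 1, hi⟩ else 0)

/-- The jets of order `L` over the domain of the system. -/
def jetDomain (S : ControlSystem n m) (L : ℕ) : Set (Jet n m L) :=
  {ζ | (ζ.1, ζ.2 0) ∈ S.domain}

theorem isOpen_jetDomain (S : ControlSystem n m) (L : ℕ) : IsOpen (S.jetDomain L) :=
  S.isOpen_domain.preimage (by fun_prop)

theorem isJetField_jetField (S : ControlSystem n m) (L : ℕ) :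
    IsJetField (S.jetDomain L) (S.jetField L) := by
  have hp : ContDiff ℝ ∞ (fun ζ : Jet n m L => (ζ.1, ζ.2 0)) := by fun_prop
  have hf : ContDiffOn ℝ ∞ (fun ζ : Jet n m L => S.f (ζ.1, ζ.2 0)) (S.jetDomain L) :=
    S.contDiffOn_f.comp hp.contDiffOn fun _ h => h
  have hs : ContDiffOn ℝ ∞ (S.jetField L) (S.jetDomain L) := by
    refine hf.prodMk (contDiffOn_pi.2 fun i => ?_)
    split_ifs
    · exact ContDiff.contDiffOn (by fun_prop)
    · exact contDiffOn_const
  refine ⟨S.isOpen_jetDomain L, hs, fun ζ _ l => ?_, fun ζ hζ l hl v => ?_⟩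
  · simp [jetField, Fin.succ]
  · have h1 := ((ContinuousLinearMap.fst ℝ (Fin n → ℝ) _).hasFDerivAt.comp ζ
      (hs.differentiableAt_of_isOpen (S.isOpen_jetDomain L) hζ).hasFDerivAt).fderiv
    have h2 := ((S.contDiffOn_f.differentiableAt_of_isOpen S.isOpen_domain hζ).hasFDerivAt.comp
      (f := fun ζ : Jet n m L => (ζ.1, ζ.2 0)) ζ
      (ContinuousLinearMap.hasFDerivAt ((ContinuousLinearMap.fst ℝ (Fin n → ℝ) _).prod
        ((ContinuousLinearMap.proj (R := ℝ) (φ := fun _ : Fin (L + 1) => Fin m → ℝ) 0).comp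
          (ContinuousLinearMap.snd ℝ _ _))))).fderiv
    have h3 := congrArg (fun T => T (inputDir n L l v)) (h1.symm.trans h2)
    refine h3.trans ?_
    simp only [inputDir, ContinuousLinearMap.comp_apply, ContinuousLinearMap.prod_apply,
      ContinuousLinearMap.coe_fst', ContinuousLinearMap.coe_snd', ContinuousLinearMap.proj_apply,
      Fin.val_zero, show (0 : ℕ) ≠ l by omega, if_false]
    exact map_zero _

variable (S : ControlSystem n m) {q L : ℕ} {φ : Jet n m q → Fin m → ℝ} {Ω : Set (Jet n m q)}

theorem contDiffOn_iterTimeDeriv (hΩ : IsOpen Ω) (hφ : ContDiffOn ℝ ∞ φ Ω) (j : ℕ) :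
    ContDiffOn ℝ ∞ (S.iterTimeDeriv φ j)
      (S.jetDomain (q + j) ∩ jetRes n m (Nat.le_add_right q j) ⁻¹' Ω) := by
  induction j with
  | zero => exact hφ.mono Set.inter_subset_right
  | succ j ih =>
    have hO : IsOpen (S.jetDomain (q + j) ∩ jetRes n m (Nat.le_add_right q j) ⁻¹' Ω) :=
      (S.isOpen_jetDomain _).inter (hΩ.preimage (jetRes n m _).continuous)
    have h1 := ih.fderiv_of_isOpen (m := ∞) hO (by simp)
    have h2 : ContDiff ℝ ∞ (jetRes n m (Nat.le_succ (q + j))) := (jetRes n m _).contDiff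
    have h3 : ContDiffOn ℝ ∞ (fun ξ : Jet n m (q + j + 1) =>
        ((S.f (ξ.1, ξ.2 0), fun i => ξ.2 i.succ) : Jet n m (q + j))) (S.jetDomain (q + j + 1)) := by
      refine ContDiffOn.prodMk ?_ (ContDiff.contDiffOn (by fun_prop))
      exact S.contDiffOn_f.comp (ContDiff.contDiffOn (by fun_prop)) fun _ h => h
    exact (h1.comp (h2.contDiffOn (s := S.jetDomain (q + (j + 1)) ∩
      jetRes n m (Nat.le_add_right q (j + 1)) ⁻¹' Ω)) fun _ h => h).clm_apply
      (h3.mono Set.inter_subset_left)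

/-- On the jets of order `L`, iterated time derivatives of total order at most `L` are
iterated Lie derivatives along the vector field of the system. -/
theorem iterTimeDeriv_jetRes (hΩ : IsOpen Ω) (hφ : ContDiffOn ℝ ∞ φ Ω) (hq : q ≤ L) (a : Fin m)
    (j : ℕ) (hj : q + j ≤ L) :
    Set.EqOn (fun ζ => S.iterTimeDeriv φ j (jetRes n m hj ζ) a)
      ((lieD (S.jetField L))^[j] fun ζ => φ (jetRes n m hq ζ) a)
      (S.jetDomain L ∩ jetRes n m hq ⁻¹' Ω) := by
  have hO : IsOpen (S.jetDomain L ∩ jetRes n m hq ⁻¹' Ω) :=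
    (S.isOpen_jetDomain _).inter (hΩ.preimage (jetRes n m _).continuous)
  induction j with
  | zero => exact fun _ _ => rfl
  | succ j ih =>
    intro ζ hζ
    have hO' : IsOpen (S.jetDomain (q + j) ∩ jetRes n m (Nat.le_add_right q j) ⁻¹' Ω) :=
      (S.isOpen_jetDomain _).inter (hΩ.preimage (jetRes n m _).continuous)
    have hj' : q + j ≤ L := by omega
    have hd := ((S.contDiffOn_iterTimeDeriv hΩ hφ j).differentiableAt_of_isOpen hO'
      (ζ := jetRes n m hj' ζ) hζ).hasFDerivAt
    rw [Function.iterate_succ_apply', ← (ih hj').lieD hO hζ]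
    have h1 := ((ContinuousLinearMap.proj (R := ℝ) a).hasFDerivAt.comp ζ
      (hd.comp ζ (jetRes n m hj').hasFDerivAt)).fderiv
    refine Eq.trans ?_ (congrArg (fun T => T (S.jetField L ζ)) h1).symm
    have h2 : jetRes n m hj' (S.jetField L ζ) = (S.f (ζ.1, ζ.2 0), fun i : Fin (q + j + 1) =>
        ζ.2 ⟨i + 1, by omega⟩) := by
      refine Prod.ext rfl (funext fun i => ?_)
      exact dif_pos (show i.val + 1 < L + 1 by omega)
    simp only [ContinuousLinearMap.comp_apply, h2]
    rfl

theorem outputJet_eq (hΩ : IsOpen Ω) (hφ : ContDiffOn ℝ ∞ φ Ω) (hq : q ≤ L) {r : ℕ}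
    (hr : q + r ≤ L + 1) {ξ : InfJet n m}
    (hξ : ξ.trunc L ∈ S.jetDomain L ∩ jetRes n m hq ⁻¹' Ω) :
    S.outputJet φ r ξ = fun (j : Fin r) a =>
      (lieD (S.jetField L))^[j] (fun ζ => φ (jetRes n m hq ζ) a) (ξ.trunc L) :=
  funext fun j => funext fun a => S.iterTimeDeriv_jetRes hΩ hφ hq a j (by omega) hξ

/-- The infinitesimal form of flatness: near the given point, a tangent vector that annihilates
the output and its derivatives up to order `r` has vanishing components along the state and the
input. -/
theorem IsFlatOutputAt.exists_determined {S : ControlSystem n m} {ξ₀ : InfJet n m}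
    (hflat : S.IsFlatOutputAt φ ξ₀) :
    ∃ r, ∀ L, ∀ hq : q ≤ L, q + r ≤ L → ∃ O ⊆ S.jetDomain L, IsOpen O ∧ ξ₀.trunc L ∈ O ∧
      (∀ a, ContDiffOn ℝ ∞ (fun ζ => φ (jetRes n m hq ζ) a) O) ∧
      ∀ ζ ∈ O, ∀ δ, (∀ j ≤ r, ∀ a, fderiv ℝ ((lieD (S.jetField L))^[j]
        fun ζ => φ (jetRes n m hq ζ) a) ζ δ = 0) → δ.1 = 0 ∧ δ.2 0 = 0 := by
  obtain ⟨hdom, ⟨Ω, hΩ, hΩ₀, hφ⟩, r, Fx, Fu, ⟨Ux, hUx, hx₀, hFx⟩, ⟨Uu, hUu, hu₀, hFu⟩, hev⟩ := hflat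
  refine ⟨r, fun L hq hL => ?_⟩
  set V := S.jetField L
  set O₁ := S.jetDomain L ∩ jetRes n m hq ⁻¹' Ω
  have hO₁ : IsOpen O₁ := (S.isOpen_jetDomain _).inter (hΩ.preimage (jetRes n m _).continuous)
  have hζ₀ : ξ₀.trunc L ∈ O₁ := ⟨hdom, hΩ₀⟩
  have hVjet : IsJetField O₁ V := (S.isJetField_jetField L).mono hO₁ Set.inter_subset_left
  have hφs (a) : ContDiffOn ℝ ∞ (fun ζ => φ (jetRes n m hq ζ) a) O₁ :=
    contDiffOn_pi.1 (hφ.comp (jetRes n m hq).contDiff.contDiffOn fun _ h => h.2) a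
  let J (k : ℕ) (ζ : Jet n m L) : Fin k → Fin m → ℝ :=
    fun j a => (lieD V)^[j] (fun ζ => φ (jetRes n m hq ζ) a) ζ
  have hJ (k : ℕ) : ContDiffOn ℝ ∞ (J k) O₁ := contDiffOn_pi.2 fun j => contDiffOn_pi.2 fun a =>
    hVjet.contDiffOn_iterate (hφs a) j
  have hJeq {k : ℕ} (hk : k ≤ r + 1) {ξ : InfJet n m} (hξ : ξ.trunc L ∈ O₁) :
      S.outputJet φ k ξ = J k (ξ.trunc L) := S.outputJet_eq hΩ hφ hq (by omega) hξ
  have hJc (k : ℕ) : ContinuousAt (J k) (ξ₀.trunc L) :=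
    ((hJ k).continuousOn.continuousAt (hO₁.mem_nhds hζ₀))
  rw [hJeq (by omega) hζ₀] at hx₀ hu₀
  have hpad : Filter.Tendsto (jetPad ξ₀ (L := L)) (𝓝 (ξ₀.trunc L)) (𝓝 ξ₀) := by
    have := (continuous_jetPad ξ₀ L).tendsto (ξ₀.trunc L)
    rwa [jetPad_trunc] at this
  have hnear : ∀ᶠ ζ in 𝓝 (ξ₀.trunc L), ζ ∈ O₁ ∧ J r ζ ∈ Ux ∧ J (r + 1) ζ ∈ Uu ∧
      ζ.1 = Fx (J r ζ) ∧ ζ.2 0 = Fu (J (r + 1) ζ) := by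
    filter_upwards [hO₁.mem_nhds hζ₀, (hJc r).eventually_mem (hUx.mem_nhds hx₀),
      (hJc (r + 1)).eventually_mem (hUu.mem_nhds hu₀), hpad.eventually hev] with ζ h1 h2 h3 h4
    have h5 : (jetPad ξ₀ ζ).trunc L ∈ O₁ := by rwa [trunc_jetPad]
    rw [hJeq (by omega) h5, hJeq (by omega) h5, trunc_jetPad] at h4
    refine ⟨h1, h2, h3, h4.1, ?_⟩
    rw [← h4.2]
    simp [jetPad]
  obtain ⟨O, hsub, hO, hmem⟩ := mem_nhds_iff.1 hnear
  have hO₁' : O ⊆ O₁ := fun ζ hζ => (hsub hζ).1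
  refine ⟨O, fun ζ hζ => (hO₁' hζ).1, hO, hmem, fun a => (hφs a).mono hO₁', fun ζ hζ δ hδ => ?_⟩
  have hJδ {k : ℕ} (hk : k ≤ r + 1) : fderiv ℝ (J k) ζ δ = 0 := by
    have hd := (hJ k).differentiableAt_of_isOpen hO₁ (hO₁' hζ)
    ext j a
    have h1 := (hasFDerivAt_pi'.1 (hasFDerivAt_pi'.1 hd.hasFDerivAt j) a).fderiv
    exact (congrArg (fun T => T δ) h1).symm.trans (hδ j (by omega) a)
  have key {F : Type} [NormedAddCommGroup F] [NormedSpace ℝ F] {k : ℕ} (hk : k ≤ r + 1)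
      {U : Set (Fin k → Fin m → ℝ)} (hU : IsOpen U) {G : (Fin k → Fin m → ℝ) → F}
      (hG : ContDiffOn ℝ ∞ G U) (hJU : J k ζ ∈ U) (P : Jet n m L →L[ℝ] F)
      (hP : Set.EqOn P (G ∘ J k) O) : P δ = 0 := by
    have h1 := ((hG.differentiableAt_of_isOpen hU hJU).hasFDerivAt.comp ζ
      ((hJ k).differentiableAt_of_isOpen hO₁ (hO₁' hζ)).hasFDerivAt).fderiv
    rw [← hP.fderiv_eq_of_isOpen hO hζ, ContinuousLinearMap.fderiv] at h1
    rw [h1, ContinuousLinearMap.comp_apply, hJδ hk, map_zero]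
  exact ⟨key (by omega) hUx hFx (hsub hζ).2.1 (ContinuousLinearMap.fst ℝ _ _)
      fun ζ hζ => (hsub hζ).2.2.2.1,
    key le_rfl hUu hFu (hsub hζ).2.2.1
      ((ContinuousLinearMap.proj (R := ℝ) (φ := fun _ : Fin (L + 1) => Fin m → ℝ) 0).comp
        (ContinuousLinearMap.snd ℝ _ _)) fun ζ hζ => (hsub hζ).2.2.2.2⟩

end ControlSystem

end Truncation

/-! ### There is no flat output depending on the state and the input -/

section NoFlatOutput

variable {L : ℕ} {O : Set (Jet 3 2 L)} {ζ : Jet 3 2 L}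

theorem ne_zero_of_mem_jetDomain (hζ : ζ ∈ exampleSystem.jetDomain L) : ζ.2 0 0 ≠ 0 := hζ

/-- The derivative of the right-hand side `f(x, u)` in the direction `v` of the input. -/
theorem fderiv_jetField_inputDir (hζ : ζ ∈ exampleSystem.jetDomain L) (v : Fin 2 → ℝ) :
    (fderiv ℝ (exampleSystem.jetField L) ζ (inputDir 3 L 0 v)).1 =
      ![v 0, v 1, ζ.2 0 1 / ζ.2 0 0 * v 1 - (ζ.2 0 1 / ζ.2 0 0) ^ 2 / 2 * v 0] := by
  have hV := exampleSystem.isJetField_jetField L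
  have hu := ne_zero_of_mem_jetDomain hζ
  have hd := ((hV.smooth.differentiableAt_of_isOpen hV.isOpen hζ).hasFDerivAt)
  have hin (a : Fin 2) := hasFDerivAt_input ζ 0 a
  have hx := hasFDerivAt_state ζ 0
  ext k
  rw [← fderiv_component hV hζ]
  fin_cases k
  · exact (fderiv_input_apply ζ _ 0 0).trans (by simp [inputDir])
  · exact (fderiv_input_apply ζ _ 0 1).trans (by simp [inputDir])
  · have h3 : HasFDerivAt (fun ζ => (exampleSystem.jetField L ζ).1 2) _ ζ :=
      (hx.add (((hin 1).pow 2).mul ((hasDerivAt_inv (x := 2 * ζ.2 0 0)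
        (by simpa)).comp_hasFDerivAt ζ ((hin 0).const_mul 2))))
    refine (congrArg (fun T => T (inputDir 3 L 0 v)) h3.fderiv).trans ?_
    simp [inputDir]
    field_simp
    ring

/-- If neither `g(x)` nor `ġ` depends on the input, then `g` is constant: `∂f/∂u₁`, `∂f/∂u₂` and
`∂²f/∂u₂²` span the space of velocities. -/
theorem fderiv_eq_zero_of_orderLT_zero {g : Jet 3 2 L → ℝ} (hO : IsOpen O)
    (hsub : O ⊆ exampleSystem.jetDomain L) (hg : ContDiffOn ℝ ∞ g O) (hord : OrderLT O 0 g)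
    (hD : ∀ ζ ∈ O, ∀ v, fderiv ℝ (lieD (exampleSystem.jetField L) g) ζ (inputDir 3 L 0 v) = 0)
    (hζ : ζ ∈ O) : fderiv ℝ g ζ = 0 := by
  have hV := (exampleSystem.isJetField_jetField L).mono hO hsub
  have hu := ne_zero_of_mem_jetDomain (hsub hζ)
  have h1 (v : Fin 2 → ℝ) : ∀ ζ ∈ O, fderiv ℝ g ζ (stateDir 2 L
      (fderiv ℝ (exampleSystem.jetField L) ζ (inputDir 3 L 0 v)).1) = 0 := fun ζ hζ => by
    have := hV.fderiv_lieD_inputDir_zero hg (hord.mono (Nat.zero_le _)) hζ v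
    rwa [hD ζ hζ, lieD_eq_zero_of_eqOn_const hO (fun ζ hζ => hord ζ hζ 0 le_rfl v) hζ, zero_add,
      eq_comm] at this
  set b : Jet 3 2 L → Fin 3 → ℝ := sVelocity (exampleSystem.jetField L) with hb
  have hbs : ContDiffOn ℝ ∞ b O :=
    ContDiffOn.fst ((hV.smooth.fderiv_of_isOpen hO (by simp)).clm_apply contDiffOn_const)
  have hbeq : Set.EqOn b (fun ζ => ![0, 1, ζ.2 0 1 / ζ.2 0 0]) O := fun ζ hζ => by
    rw [hb, sVelocity, sDir, fderiv_jetField_inputDir (hsub hζ)]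
    simp
  have hin (a : Fin 2) := hasFDerivAt_input ζ 0 a
  have hb' : fderiv ℝ b ζ (sDir L 0) = ![0, 0, (ζ.2 0 0)⁻¹] := by
    have hbk (k : Fin 3) : fderiv ℝ b ζ (sDir L 0) k = fderiv ℝ (fun ζ => b ζ k) ζ (sDir L 0) := by
      rw [fderiv_apply (hbs.differentiableAt_of_isOpen hO hζ)]; rfl
    have hbk' (k : Fin 3) := Set.EqOn.fderiv_eq_of_isOpen (f₁ := fun ζ => b ζ k)
      (fun ζ hζ => congrFun (hbeq hζ) k) hO hζ
    ext k
    rw [hbk, hbk']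
    fin_cases k
    · exact congrArg (fun T : Jet 3 2 L →L[ℝ] ℝ => T (sDir L 0))
        (hasFDerivAt_const (𝕜 := ℝ) (0 : ℝ) ζ).fderiv
    · exact congrArg (fun T : Jet 3 2 L →L[ℝ] ℝ => T (sDir L 0))
        (hasFDerivAt_const (𝕜 := ℝ) (1 : ℝ) ζ).fderiv
    · have h3 := (hin 1).mul ((hasDerivAt_inv hu).comp_hasFDerivAt ζ (hin 0))
      refine (congrArg (fun T => T (sDir L 0)) h3.fderiv).trans ?_
      simp [inputDir]
  have h2 : fderiv ℝ g ζ (xDir L 2) = 0 := by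
    have := fderiv_fderiv_stateDir hO hbs hg (h1 (Pi.single 1 1)) hζ (sDir L 0)
    have h00 : ![0, 0, (ζ.2 0 0)⁻¹] = (ζ.2 0 0)⁻¹ • (Pi.single 2 1 : Fin 3 → ℝ) := by
      ext k; fin_cases k <;> simp
    rw [fderiv_eq_zero_of_eqOn_const hO (fun ζ hζ => hord ζ hζ 0 le_rfl _) hζ, hb', h00,
      stateDir_smul, map_smul, zero_apply, zero_add] at this
    exact (smul_eq_zero.1 this).resolve_left (inv_ne_zero hu)
  have h3 := h1 (Pi.single 1 1) ζ hζ
  have h4 := h1 (Pi.single 0 1) ζ hζ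
  rw [fderiv_jetField_inputDir (hsub hζ), map_stateDir_three, h2] at h3 h4
  simp at h3 h4
  ext δ
  · have := fderiv_eq_of_orderLT_zero hord hζ (stateDir 2 L δ)
    exact (map_stateDir_three (fderiv ℝ g ζ) δ).trans (by rw [h2, h3, h4]; simp)
  · exact fderiv_eq_of_orderLT_zero hord hζ (0, δ) |>.trans (map_zero _)

theorem not_hasFlatOutput_zero : ¬ exampleSystem.HasFlatOutput 0 := by
  rintro ⟨φ, ξ₀, hflat⟩
  obtain ⟨r, hr⟩ := hflat.exists_determined
  obtain ⟨L, hL⟩ : ∃ L, L = r + 1 := ⟨_, rfl⟩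
  obtain ⟨O, hsub, hO, hξ₀, hφ, hdet⟩ := hr L (Nat.zero_le _) (by omega)
  set V := exampleSystem.jetField L
  set ψ : Fin 2 → Jet 3 2 L → ℝ := fun a ζ => φ (jetRes 3 2 (Nat.zero_le L) ζ) a with hψ
  have hV : IsJetField O V := (exampleSystem.isJetField_jetField L).mono hO hsub
  have hord (a : Fin 2) : OrderLT O 1 (ψ a) := fun ζ hζ l hl v => by
    have h0 (ζ : Jet 3 2 L) (t : ℝ) : ψ a (ζ + t • inputDir 3 L l v) = ψ a ζ := by
      have : jetRes 3 2 (Nat.zero_le L) (inputDir 3 L l v) = 0 := by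
        refine Prod.ext rfl (funext fun i => ?_)
        have : i.val ≠ l := by omega
        exact if_neg this
      simp only [hψ, map_add, map_smul, this, smul_zero, add_zero]
    have h1 := (((hφ a).differentiableAt_of_isOpen hO hζ).hasFDerivAt.hasLineDerivAt
      (inputDir 3 L l v)).lineDeriv
    refine h1.symm.trans ?_
    show deriv (fun t : ℝ => ψ a (ζ + t • inputDir 3 L l v)) 0 = 0
    simp only [h0, deriv_const]
  have hstate : ∀ ζ ∈ O, (V ζ).1 =
      ![ζ.2 0 0, ζ.2 0 1, ζ.1 0 + ζ.2 0 1 ^ 2 / (2 * ζ.2 0 0)] := fun _ _ => rfl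
  have hne : ∀ ζ ∈ O, ζ.2 0 0 ≠ 0 := fun ζ hζ => hsub hζ
  have hcases (a j : Fin 2) : j = a ∨ j = a + 1 := by revert a j; decide
  by_cases hu : ∃ a, ∃ ζ ∈ O, ∃ k : Fin 2, fderiv ℝ (ψ a) ζ (inputDir 3 L 0 (Pi.single k 1)) ≠ 0
  · obtain ⟨a, ζ, hζ, k, hk⟩ := hu
    refine false_of_determined (r := r) (by omega) hV hstate hne (c := fun _ => 0) (hφ a)
      contDiffOn_const (hφ (a + 1)) (hord a) (fun ζ _ l _ v => by simp) (hord (a + 1))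
      (Or.inl fun _ _ => rfl) (fun ζ hζ δ _ h1 h2 => hdet ζ hζ δ fun j hj b => ?_) hζ hk
    rcases hcases a b with rfl | rfl
    · exact h1 j (by omega)
    · exact h2 j hj
  · push Not at hu
    have hord0 (a : Fin 2) : OrderLT O 0 (ψ a) := fun ζ hζ l _ v => by
      rcases l with _ | l
      · rw [map_inputDir_two, hu a ζ hζ, hu a ζ hζ, mul_zero, mul_zero, add_zero]
      · exact hord a ζ hζ _ (by omega) v
    by_cases hu' : ∃ a, ∃ ζ ∈ O, ∃ k : Fin 2,
        fderiv ℝ (lieD V (ψ a)) ζ (inputDir 3 L 0 (Pi.single k 1)) ≠ 0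
    · obtain ⟨a, ζ, hζ, k, hk⟩ := hu'
      refine false_of_determined (r := r) (by omega) hV hstate hne
        (ContDiffOn.lieD hO hV.smooth (hφ a)) (hφ a) (hφ (a + 1))
        (hV.orderLT_lieD (hφ a) (hord0 a) (Nat.zero_le _)) (hord0 a) (hord (a + 1))
        (Or.inr fun _ _ => rfl) (fun ζ hζ δ h0 h1 h2 => hdet ζ hζ δ fun j hj b => ?_) hζ hk
      rcases hcases a b with rfl | rfl
      · rcases j with _ | j
        · exact h0
        · exact h1 j (by omega)
      · exact h2 j hj
    · push Not at hu'
      have hzero (a : Fin 2) : ∀ ζ ∈ O, fderiv ℝ (ψ a) ζ = 0 := fun ζ hζ =>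
        fderiv_eq_zero_of_orderLT_zero hO hsub (hφ a) (hord0 a) (fun ζ hζ v => by
          rw [map_inputDir_two, hu' a ζ hζ, hu' a ζ hζ, mul_zero, mul_zero, add_zero]) hζ
      have hiter (a : Fin 2) (j : ℕ) : ∀ ζ ∈ O, fderiv ℝ ((lieD V)^[j] (ψ a)) ζ = 0 := by
        induction j with
        | zero => exact hzero a
        | succ j ih =>
          intro ζ hζ
          rw [Function.iterate_succ_apply']
          exact fderiv_eq_zero_of_eqOn_const hO
            (fun ζ hζ => by rw [lieD, ih ζ hζ, zero_apply]) hζ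
      have h := (hdet _ hξ₀ (xDir L 0) fun j _ a => by rw [hiter a j _ hξ₀, zero_apply]).1
      simpa [stateDir] using congrFun h 0

end NoFlatOutput

/-! ### The explicit flat output -/

section ExplicitFlatOutput

section HasLieD

variable {E : Type*} [NormedAddCommGroup E] [NormedSpace ℝ E] {V : E → E} {g h : E → ℝ}
  {g' h' : ℝ} {ζ : E}

/-- `g` is differentiable at `ζ`, and `g'` is its derivative along `V` there. -/
def HasLieD (V : E → E) (g : E → ℝ) (g' : ℝ) (ζ : E) : Prop :=
  DifferentiableAt ℝ g ζ ∧ lieD V g ζ = g'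

namespace HasLieD

theorem const (c : ℝ) : HasLieD V (fun _ => c) 0 ζ :=
  ⟨differentiableAt_const c, by simp [lieD]⟩

theorem add (hg : HasLieD V g g' ζ) (hh : HasLieD V h h' ζ) :
    HasLieD V (fun ζ => g ζ + h ζ) (g' + h') ζ :=
  ⟨hg.1.add hh.1, by rw [← hg.2, ← hh.2]; simp [lieD, fderiv_fun_add hg.1 hh.1]⟩

theorem sub (hg : HasLieD V g g' ζ) (hh : HasLieD V h h' ζ) :
    HasLieD V (fun ζ => g ζ - h ζ) (g' - h') ζ :=
  ⟨hg.1.sub hh.1, by rw [← hg.2, ← hh.2]; simp [lieD, fderiv_fun_sub hg.1 hh.1]⟩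

theorem mul (hg : HasLieD V g g' ζ) (hh : HasLieD V h h' ζ) :
    HasLieD V (fun ζ => g ζ * h ζ) (g ζ * h' + g' * h ζ) ζ :=
  ⟨hg.1.mul hh.1, by rw [← hg.2, ← hh.2]; simp [lieD, fderiv_fun_mul hg.1 hh.1, mul_comm]⟩

end HasLieD

end HasLieD

variable {L : ℕ} {ζ : Jet 3 2 L}

/-- The quotient `p = u₂ / u₁`, the first component of the flat output. -/
def inputRatio (L : ℕ) (ζ : Jet 3 2 L) : ℝ := ζ.2 0 1 / ζ.2 0 0

/-- The derivatives `p^(i)` along the system. -/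
def ratioIter (L i : ℕ) : Jet 3 2 L → ℝ := (lieD (exampleSystem.jetField L))^[i] (inputRatio L)

/-- The function `x₂ - p x₁`, which satisfies `ȧ = -ṗ x₁`. -/
def reducedA (L : ℕ) (ζ : Jet 3 2 L) : ℝ := ζ.1 1 - inputRatio L ζ * ζ.1 0

/-- The function `x₃ - p² x₁ / 2`, which satisfies `ḃ = (1 - p ṗ) x₁`. -/
def reducedB (L : ℕ) (ζ : Jet 3 2 L) : ℝ :=
  ζ.1 2 - 1 / 2 * (inputRatio L ζ * inputRatio L ζ) * ζ.1 0

theorem contDiffOn_inputRatio : ContDiffOn ℝ ∞ (inputRatio L) (exampleSystem.jetDomain L) :=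
  ContDiffOn.div (f := fun ζ : Jet 3 2 L => ζ.2 0 1) (g := fun ζ : Jet 3 2 L => ζ.2 0 0)
    (ContDiff.contDiffOn (by fun_prop)) (ContDiff.contDiffOn (by fun_prop))
    fun _ hζ => ne_zero_of_mem_jetDomain hζ

theorem fderiv_inputRatio (hζ : ζ ∈ exampleSystem.jetDomain L) (δ : Jet 3 2 L) :
    fderiv ℝ (inputRatio L) ζ δ = (δ.2 0 1 - inputRatio L ζ * δ.2 0 0) / ζ.2 0 0 := by
  have hu := ne_zero_of_mem_jetDomain hζ
  have hin (a : Fin 2) := hasFDerivAt_input ζ 0 a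
  have h3 := (hin 1).mul ((hasDerivAt_inv hu).comp_hasFDerivAt ζ (hin 0))
  refine (congrArg (fun T => T δ) h3.fderiv).trans ?_
  simp [inputRatio]
  field_simp
  ring

theorem orderLT_inputRatio :
    OrderLT (exampleSystem.jetDomain L) 1 (inputRatio L) := fun ζ hζ l hl v => by
  rw [fderiv_inputRatio hζ]; simp [inputDir, show (0 : ℕ) ≠ l by omega]

theorem contDiffOn_ratioIter (i : ℕ) :
    ContDiffOn ℝ ∞ (ratioIter L i) (exampleSystem.jetDomain L) :=
  (exampleSystem.isJetField_jetField L).contDiffOn_iterate contDiffOn_inputRatio i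

theorem hasLieD_ratioIter (hζ : ζ ∈ exampleSystem.jetDomain L) (i : ℕ) :
    HasLieD (exampleSystem.jetField L) (ratioIter L i) (ratioIter L (i + 1) ζ) ζ :=
  ⟨(contDiffOn_ratioIter i).differentiableAt_of_isOpen (exampleSystem.isOpen_jetDomain L) hζ, by
    simp only [ratioIter, Function.iterate_succ_apply']⟩

theorem hasLieD_state (k : Fin 3) : HasLieD (exampleSystem.jetField L) (fun ζ => ζ.1 k)
    (exampleSystem.f (ζ.1, ζ.2 0) k) ζ :=
  ⟨by fun_prop, fderiv_state_apply ζ _ k⟩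

theorem hasLieD_reducedA (hζ : ζ ∈ exampleSystem.jetDomain L) :
    HasLieD (exampleSystem.jetField L) (reducedA L) (-ratioIter L 1 ζ * ζ.1 0) ζ := by
  have hu := ne_zero_of_mem_jetDomain hζ
  have h := (hasLieD_state (ζ := ζ) 1).sub ((hasLieD_ratioIter hζ 0).mul (hasLieD_state 0))
  refine ⟨h.1, h.2.trans ?_⟩
  have h0 : ratioIter L 0 ζ = ζ.2 0 1 / ζ.2 0 0 := rfl
  rw [h0]
  simp [exampleSystem]
  field_simp
  ring

theorem hasLieD_reducedB (hζ : ζ ∈ exampleSystem.jetDomain L) :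
    HasLieD (exampleSystem.jetField L) (reducedB L)
      ((1 - ratioIter L 0 ζ * ratioIter L 1 ζ) * ζ.1 0) ζ := by
  have hu := ne_zero_of_mem_jetDomain hζ
  have hp := hasLieD_ratioIter hζ 0
  have h := (hasLieD_state (ζ := ζ) 2).sub (((HasLieD.const (1 / 2)).mul (hp.mul hp)).mul
    (hasLieD_state 0))
  refine ⟨h.1, h.2.trans ?_⟩
  have h0 : ratioIter L 0 ζ = ζ.2 0 1 / ζ.2 0 0 := rfl
  rw [h0]
  simp [exampleSystem]
  field_simp
  ring

/-- The second component of the flat output as a function of the jets of order `L`. -/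
def secondOutput (L : ℕ) (hL : 1 ≤ L) (ζ : Jet 3 2 L) : ℝ := exampleOutput (jetRes 3 2 hL ζ) 1

theorem ratioIter_one (hL : 1 ≤ L) (hζ : ζ ∈ exampleSystem.jetDomain L) :
    ratioIter L 1 ζ = (ζ.2 ⟨1, by omega⟩ 1 - inputRatio L ζ * ζ.2 ⟨1, by omega⟩ 0) / ζ.2 0 0 := by
  refine (fderiv_inputRatio hζ _).trans ?_
  have h (a : Fin 2) : (exampleSystem.jetField L ζ).2 0 a = ζ.2 ⟨1, by omega⟩ a := by
    simp [ControlSystem.jetField, show 0 < L by omega]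
  rw [h, h]

theorem secondOutput_eq (hL : 1 ≤ L) : Set.EqOn (secondOutput L hL)
    (fun ζ => 2 * (1 - ratioIter L 0 ζ * ratioIter L 1 ζ) * reducedA L ζ +
      2 * ratioIter L 1 ζ * reducedB L ζ) (exampleSystem.jetDomain L) := fun ζ hζ => by
  have hu := ne_zero_of_mem_jetDomain hζ
  have h0 : ratioIter L 0 ζ = ζ.2 0 1 / ζ.2 0 0 := rfl
  simp only [ratioIter_one hL hζ, h0, reducedA, reducedB, inputRatio]
  have e0 : (jetRes 3 2 hL ζ).2 0 = ζ.2 0 := rfl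
  have e1 : (jetRes 3 2 hL ζ).2 1 = ζ.2 ⟨1, by omega⟩ := rfl
  have e2 : (jetRes 3 2 hL ζ).1 = ζ.1 := rfl
  simp only [secondOutput, exampleOutput, e0, e1, e2, Matrix.cons_val_one, Matrix.cons_val_zero]
  field_simp
  ring

/-- The first derivative of the second component of the flat output is again linear in `a` and `b`,
without a term in `x₁`, because `(1 - p ṗ) ȧ + ṗ ḃ = 0`. -/
theorem lieD_secondOutput (hL : 1 ≤ L) :
    Set.EqOn (lieD (exampleSystem.jetField L) (secondOutput L hL))
    (fun ζ => 2 * ratioIter L 2 ζ * reducedB L ζ -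
      2 * (ratioIter L 1 ζ * ratioIter L 1 ζ + ratioIter L 0 ζ * ratioIter L 2 ζ) * reducedA L ζ)
    (exampleSystem.jetDomain L) := fun ζ hζ => by
  have hp := hasLieD_ratioIter hζ
  have hA := hasLieD_reducedA hζ
  have hB := hasLieD_reducedB hζ
  rw [(secondOutput_eq hL).lieD (exampleSystem.isOpen_jetDomain L) hζ]
  refine ((((HasLieD.const 2).mul ((HasLieD.const 1).sub ((hp 0).mul (hp 1)))).mul hA).add
    (((HasLieD.const 2).mul (hp 1)).mul hB)).2.trans ?_
  ring

theorem lieD_iterate_two_secondOutput (hL : 1 ≤ L) :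
    Set.EqOn ((lieD (exampleSystem.jetField L))^[2] (secondOutput L hL))
    (fun ζ => 2 * ratioIter L 3 ζ * reducedB L ζ -
      2 * (3 * (ratioIter L 1 ζ * ratioIter L 2 ζ) + ratioIter L 0 ζ * ratioIter L 3 ζ) *
        reducedA L ζ +
      2 * (ratioIter L 1 ζ * (ratioIter L 1 ζ * ratioIter L 1 ζ) + ratioIter L 2 ζ) * ζ.1 0)
    (exampleSystem.jetDomain L) := fun ζ hζ => by
  have hp := hasLieD_ratioIter hζ
  have hA := hasLieD_reducedA hζ
  have hB := hasLieD_reducedB hζ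
  rw [Function.iterate_succ_apply', Function.iterate_one,
    (lieD_secondOutput hL).lieD (exampleSystem.isOpen_jetDomain L) hζ]
  refine ((((HasLieD.const 2).mul (hp 2)).mul hB).sub (((HasLieD.const 2).mul
    (((hp 1).mul (hp 1)).add ((hp 0).mul (hp 2)))).mul hA)).2.trans ?_
  ring

theorem lieD_iterate_three_secondOutput (hL : 1 ≤ L) :
    Set.EqOn ((lieD (exampleSystem.jetField L))^[3] (secondOutput L hL))
    (fun ζ => 2 * ratioIter L 4 ζ * reducedB L ζ -
      2 * (3 * ratioIter L 2 ζ ^ 2 + 4 * ratioIter L 1 ζ * ratioIter L 3 ζ +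
        ratioIter L 0 ζ * ratioIter L 4 ζ) * reducedA L ζ +
      (12 * ratioIter L 1 ζ ^ 2 * ratioIter L 2 ζ + 4 * ratioIter L 3 ζ) * ζ.1 0 +
      2 * (ratioIter L 1 ζ ^ 3 + ratioIter L 2 ζ) * ζ.2 0 0)
    (exampleSystem.jetDomain L) := fun ζ hζ => by
  have hp := hasLieD_ratioIter hζ
  have hA := hasLieD_reducedA hζ
  have hB := hasLieD_reducedB hζ
  rw [Function.iterate_succ_apply',
    (lieD_iterate_two_secondOutput hL).lieD (exampleSystem.isOpen_jetDomain L) hζ]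
  refine (((((HasLieD.const 2).mul (hp 3)).mul hB).sub (((HasLieD.const 2).mul
    (((HasLieD.const 3).mul ((hp 1).mul (hp 2))).add ((hp 0).mul (hp 3)))).mul hA)).add
    (((HasLieD.const 2).mul (((hp 1).mul ((hp 1).mul (hp 1))).add (hp 2))).mul
      (hasLieD_state 0))).2.trans ?_
  have : exampleSystem.f (ζ.1, ζ.2 0) 0 = ζ.2 0 0 := rfl
  rw [this]
  ring

/-- The jets at which `u₁ ≠ 0` and `ṗ³ + p̈ ≠ 0`. -/
def regularJets (L : ℕ) : Set (Jet 3 2 L) :=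
  exampleSystem.jetDomain L ∩ {ζ | ratioIter L 1 ζ ^ 3 + ratioIter L 2 ζ ≠ 0}

theorem isOpen_regularJets (L : ℕ) : IsOpen (regularJets L) :=
  ContinuousOn.isOpen_inter_preimage
    (((contDiffOn_ratioIter 1).pow 3).add (contDiffOn_ratioIter 2)).continuousOn
    (exampleSystem.isOpen_jetDomain L) isOpen_ne

/-- Both `u₁` and, where `u₁ ≠ 0`, `ṗ³ + p̈` have a nonvanishing derivative, with respect to `u₁`
and `ü₂` respectively, hence neither vanishes on an open set. -/
theorem dense_regularJets (hL : 2 ≤ L) : Dense (regularJets L) := by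
  refine dense_iff_inter_open.2 fun U hU ⟨ζ, hζ⟩ => ?_
  have h1 : (U ∩ exampleSystem.jetDomain L).Nonempty := by
    by_contra hemp
    have h0 : ∀ ζ ∈ U, ζ.2 0 0 = 0 := fun ζ hζ => by
      by_contra hne; exact hemp ⟨ζ, hζ, hne⟩
    have := congrArg (fun T => T (inputDir 3 L 0 (Pi.single 0 1)))
      (fderiv_eq_zero_of_eqOn_const hU h0 hζ)
    simp [fderiv_input_apply, inputDir] at this
  obtain ⟨ζ, hζU, hζ⟩ := h1
  by_contra hemp
  have hU' : IsOpen (U ∩ exampleSystem.jetDomain L) :=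
    hU.inter (exampleSystem.isOpen_jetDomain L)
  have h0 : ∀ ζ ∈ U ∩ exampleSystem.jetDomain L, ratioIter L 1 ζ ^ 3 + ratioIter L 2 ζ = 0 :=
    fun ζ hζ => by by_contra hne; exact hemp ⟨ζ, hζ.1, hζ.2, hne⟩
  have h2 := congrArg (fun T => T (inputDir 3 L 2 (Pi.single 1 1)))
    (fderiv_eq_zero_of_eqOn_const hU' h0 ⟨hζU, hζ⟩)
  have hV := exampleSystem.isJetField_jetField L
  have hd (i : ℕ) := ((contDiffOn_ratioIter i).differentiableAt_of_isOpen
    (exampleSystem.isOpen_jetDomain L) hζ).hasFDerivAt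
  have h3 := congrArg (fun T => T (inputDir 3 L 2 (Pi.single 1 1)))
    (((hd 1).pow 3).add (hd 2)).fderiv
  have h4 : fderiv ℝ (ratioIter L 1) ζ (inputDir 3 L 2 (Pi.single 1 1)) = 0 :=
    hV.orderLT_iterate contDiffOn_inputRatio orderLT_inputRatio 1 (by omega) ζ hζ 2 le_rfl _
  have h5 : fderiv ℝ (ratioIter L 2) ζ (inputDir 3 L 2 (Pi.single 1 1)) = (ζ.2 0 0)⁻¹ := by
    have := hV.fderiv_iterate_inputDir contDiffOn_inputRatio orderLT_inputRatio 2 (by omega) hζ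
      (Pi.single 1 1)
    rw [fderiv_inputRatio hζ] at this
    refine this.trans ?_
    simp [inputDir]
  have h6 := h3.symm.trans h2
  simp [h4, h5] at h6
  exact ne_zero_of_mem_jetDomain hζ h6

theorem contDiffOn_exampleOutput : ContDiffOn ℝ ∞ exampleOutput {ξ : Jet 3 2 1 | ξ.2 0 0 ≠ 0} := by
  have hx (k : Fin 3) : ContDiffOn ℝ ∞ (fun ξ : Jet 3 2 1 => ξ.1 k) {ξ | ξ.2 0 0 ≠ 0} :=
    ContDiff.contDiffOn (by fun_prop)
  have hu (i a : Fin 2) : ContDiffOn ℝ ∞ (fun ξ : Jet 3 2 1 => ξ.2 i a) {ξ | ξ.2 0 0 ≠ 0} :=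
    ContDiff.contDiffOn (by fun_prop)
  have hne (k : ℕ) : ∀ ξ ∈ {ξ : Jet 3 2 1 | ξ.2 0 0 ≠ 0}, ξ.2 0 0 ^ k ≠ 0 :=
    fun ξ hξ => pow_ne_zero k hξ
  have hne1 : ∀ ξ ∈ {ξ : Jet 3 2 1 | ξ.2 0 0 ≠ 0}, ξ.2 0 0 ≠ 0 := fun ξ hξ => hξ
  refine contDiffOn_pi.2 fun a => ?_
  fin_cases a
  · exact (hu 0 1).div (hu 0 0) hne1
  · exact ((((contDiffOn_const.mul (hx 1)).sub ((contDiffOn_const.div (hu 0 0) hne1).mul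
      (((hx 0).mul (hu 0 1)).sub ((hx 2).mul (hu 1 1))))).sub
      ((contDiffOn_const.mul ((hu 0 1).div ((hu 0 0).pow 2) (hne 2))).mul
        (((hx 1).mul (hu 1 1)).add ((hx 2).mul (hu 1 0))))).add
      ((((hu 0 1).pow 2).div ((hu 0 0).pow 3) (hne 3)).mul (((hx 0).mul (hu 1 1)).add
        ((contDiffOn_const.mul (hx 1)).mul (hu 1 0))))).sub
      ((contDiffOn_const.div ((hu 0 0).pow 4) (hne 4)).mul
        (((hx 0).mul (hu 1 0)).mul ((hu 0 1).pow 3)))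

theorem isOpen_setOf_input_ne_zero : IsOpen {ξ : Jet 3 2 1 | ξ.2 0 0 ≠ 0} :=
  isOpen_ne_fun (by fun_prop) continuous_const

theorem outputJet_exampleOutput {r : ℕ} (hL : 1 ≤ L) (hr : r ≤ L) {ξ : InfJet 3 2}
    (hξ : ξ.2 0 0 ≠ 0) : exampleSystem.outputJet exampleOutput r ξ = fun (j : Fin r) =>
      ![ratioIter L j (ξ.trunc L),
        (lieD (exampleSystem.jetField L))^[j] (secondOutput L hL) (ξ.trunc L)] := by
  rw [exampleSystem.outputJet_eq (L := L) isOpen_setOf_input_ne_zero contDiffOn_exampleOutput hL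
    (by omega) ⟨hξ, hξ⟩]
  ext j a
  fin_cases a <;> rfl

theorem mem_exampleRegularSet_iff (hL : 3 ≤ L) (ξ : InfJet 3 2) :
    ξ ∈ exampleRegularSet ↔ ξ.trunc L ∈ regularJets L := by
  have h : ξ.2 0 0 ≠ 0 → (exampleSystem.outputJet exampleOutput 3 ξ 1 0 ^ 3 +
      exampleSystem.outputJet exampleOutput 3 ξ 2 0 =
      ratioIter L 1 (ξ.trunc L) ^ 3 + ratioIter L 2 (ξ.trunc L)) := fun hξ => by
    rw [outputJet_exampleOutput (L := L) (by omega) hL hξ]; rfl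
  constructor
  · rintro ⟨h1, h2⟩
    rw [h h1] at h2
    exact ⟨h1, h2⟩
  · rintro ⟨h1, h2⟩
    refine ⟨h1, ?_⟩
    rw [h h1]
    exact h2

theorem InfJet.continuous_trunc {n m : ℕ} (k : ℕ) : Continuous (InfJet.trunc (n := n) (m := m) k) :=
  continuous_fst.prodMk (by fun_prop)

theorem isOpen_exampleRegularSet : IsOpen exampleRegularSet := by
  have : exampleRegularSet = InfJet.trunc 3 ⁻¹' regularJets 3 :=
    Set.ext fun ξ => mem_exampleRegularSet_iff le_rfl ξ
  rw [this]
  exact (isOpen_regularJets 3).preimage (InfJet.continuous_trunc 3)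

theorem dense_exampleRegularSet : Dense exampleRegularSet := by
  refine dense_iff_inter_open.2 fun U hU ⟨ξ, hξ⟩ => ?_
  obtain ⟨ζ, hζU, hζ⟩ := (dense_regularJets (L := 3) (by omega)).inter_open_nonempty
    (jetPad ξ ⁻¹' U) (hU.preimage (continuous_jetPad ξ 3))
    ⟨ξ.trunc 3, by rwa [Set.mem_preimage, jetPad_trunc]⟩
  refine ⟨jetPad ξ ζ, hζU, (mem_exampleRegularSet_iff le_rfl _).2 ?_⟩
  rwa [trunc_jetPad]

/-- The determinant `ṗ³ + p̈` as a function of the derivatives of the flat output; `η j` holds the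
`j`-th derivatives of both components. The number `r + 4` of derivatives is kept variable because
the formulas for the state are used both with four of them and, for the input, with five. -/
def detOf {r : ℕ} (η : Fin (r + 4) → Fin 2 → ℝ) : ℝ := η 1 0 ^ 3 + η 2 0

/-- The function `a = x₂ - p x₁` in terms of the derivatives of the flat output. -/
def reducedAOf {r : ℕ} (η : Fin (r + 4) → Fin 2 → ℝ) : ℝ :=
  (η 0 1 * η 2 0 - η 1 1 * η 1 0) / (2 * detOf η)

/-- The function `b = x₃ - p² x₁ / 2` in terms of the derivatives of the flat output. -/
def reducedBOf {r : ℕ} (η : Fin (r + 4) → Fin 2 → ℝ) : ℝ :=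
  (η 1 1 * (1 - η 0 0 * η 1 0) + η 0 1 * (η 1 0 ^ 2 + η 0 0 * η 2 0)) / (2 * detOf η)

/-- The state `x₁` in terms of the derivatives of the flat output. -/
def state₁Of {r : ℕ} (η : Fin (r + 4) → Fin 2 → ℝ) : ℝ :=
  (η 2 1 / 2 + (3 * η 1 0 * η 2 0 + η 0 0 * η 3 0) * reducedAOf η - η 3 0 * reducedBOf η) / detOf η

/-- The state in terms of the derivatives of the flat output. -/
def stateOf {r : ℕ} (η : Fin (r + 4) → Fin 2 → ℝ) : Fin 3 → ℝ :=
  ![state₁Of η, reducedAOf η + η 0 0 * state₁Of η, reducedBOf η + η 0 0 ^ 2 / 2 * state₁Of η]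

/-- The input `u₁` in terms of the derivatives of the flat output. -/
def input₁Of (η : Fin 5 → Fin 2 → ℝ) : ℝ :=
  (η 3 1 / 2 + (3 * η 2 0 ^ 2 + 4 * η 1 0 * η 3 0 + η 0 0 * η 4 0) * reducedAOf (r := 1) η -
    η 4 0 * reducedBOf (r := 1) η - (6 * η 1 0 ^ 2 * η 2 0 + 2 * η 3 0) * state₁Of (r := 1) η) /
    detOf (r := 1) η

/-- The input in terms of the derivatives of the flat output. -/
def inputOf (η : Fin 5 → Fin 2 → ℝ) : Fin 2 → ℝ := ![input₁Of η, η 0 0 * input₁Of η]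

section Smooth

variable {r : ℕ}

theorem contDiff_detOf : ContDiff ℝ ∞ (detOf (r := r)) := by unfold detOf; fun_prop

theorem isOpen_setOf_detOf_ne_zero : IsOpen {η | detOf (r := r) η ≠ 0} :=
  isOpen_ne_fun contDiff_detOf.continuous continuous_const

theorem contDiffOn_entry {N : ℕ} (j : Fin N) (a : Fin 2) {U : Set (Fin N → Fin 2 → ℝ)} :
    ContDiffOn ℝ ∞ (fun η : Fin N → Fin 2 → ℝ => η j a) U :=
  ContDiff.contDiffOn (by fun_prop)

theorem contDiffOn_reducedAOf : ContDiffOn ℝ ∞ (reducedAOf (r := r)) {η | detOf η ≠ 0} :=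
  (((contDiffOn_entry 0 1).mul (contDiffOn_entry 2 0)).sub ((contDiffOn_entry 1 1).mul
    (contDiffOn_entry 1 0))).div (contDiffOn_const.mul contDiff_detOf.contDiffOn)
    fun _ hη => mul_ne_zero two_ne_zero hη

theorem contDiffOn_reducedBOf : ContDiffOn ℝ ∞ (reducedBOf (r := r)) {η | detOf η ≠ 0} := by
  refine ContDiffOn.div (ContDiff.contDiffOn ?_) (contDiffOn_const.mul contDiff_detOf.contDiffOn)
    fun _ hη => mul_ne_zero two_ne_zero hη
  fun_prop

theorem contDiffOn_state₁Of : ContDiffOn ℝ ∞ (state₁Of (r := r)) {η | detOf η ≠ 0} := by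
  refine ContDiffOn.div (((ContDiff.contDiffOn ?_).add ((ContDiff.contDiffOn ?_).mul
    contDiffOn_reducedAOf)).sub ((contDiffOn_entry 3 0).mul contDiffOn_reducedBOf))
    contDiff_detOf.contDiffOn fun _ hη => hη
  all_goals fun_prop

theorem contDiffOn_stateOf : ContDiffOn ℝ ∞ (stateOf (r := r)) {η | detOf η ≠ 0} := by
  refine contDiffOn_pi.2 fun k => ?_
  fin_cases k
  · exact contDiffOn_state₁Of
  · exact contDiffOn_reducedAOf.add ((contDiffOn_entry 0 0).mul contDiffOn_state₁Of)
  · exact contDiffOn_reducedBOf.add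
      ((((contDiffOn_entry 0 0).pow 2).div_const 2).mul contDiffOn_state₁Of)

theorem contDiffOn_input₁Of : ContDiffOn ℝ ∞ input₁Of {η | detOf (r := 1) η ≠ 0} := by
  refine ContDiffOn.div ((((ContDiff.contDiffOn ?_).add ((ContDiff.contDiffOn ?_).mul
    contDiffOn_reducedAOf)).sub ((contDiffOn_entry 4 0).mul contDiffOn_reducedBOf)).sub
    ((ContDiff.contDiffOn ?_).mul contDiffOn_state₁Of))
    contDiff_detOf.contDiffOn fun _ hη => hη
  all_goals fun_prop

theorem contDiffOn_inputOf : ContDiffOn ℝ ∞ inputOf {η | detOf (r := 1) η ≠ 0} := by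
  refine contDiffOn_pi.2 fun k => ?_
  fin_cases k
  · exact contDiffOn_input₁Of
  · exact (contDiffOn_entry 0 0).mul contDiffOn_input₁Of

end Smooth

theorem reducedAOf_eq {r : ℕ} {η : Fin (r + 4) → Fin 2 → ℝ} (hη : detOf η ≠ 0) {a b : ℝ}
    (h0 : η 0 1 = 2 * (1 - η 0 0 * η 1 0) * a + 2 * η 1 0 * b)
    (h1 : η 1 1 = 2 * η 2 0 * b - 2 * (η 1 0 * η 1 0 + η 0 0 * η 2 0) * a) :
    reducedAOf η = a := by
  rw [reducedAOf, h0, h1, div_eq_iff (mul_ne_zero two_ne_zero hη), detOf]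
  ring

theorem reducedBOf_eq {r : ℕ} {η : Fin (r + 4) → Fin 2 → ℝ} (hη : detOf η ≠ 0) {a b : ℝ}
    (h0 : η 0 1 = 2 * (1 - η 0 0 * η 1 0) * a + 2 * η 1 0 * b)
    (h1 : η 1 1 = 2 * η 2 0 * b - 2 * (η 1 0 * η 1 0 + η 0 0 * η 2 0) * a) :
    reducedBOf η = b := by
  rw [reducedBOf, h0, h1, div_eq_iff (mul_ne_zero two_ne_zero hη), detOf]
  ring

/-- The values at `ζ` of the derivatives of the flat output, of order less than `N`. -/
def outputAt (L : ℕ) (hL : 1 ≤ L) (N : ℕ) (ζ : Jet 3 2 L) : Fin N → Fin 2 → ℝ := fun j =>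
  ![ratioIter L j ζ, (lieD (exampleSystem.jetField L))^[j] (secondOutput L hL) ζ]

theorem detOf_outputAt (hL : 1 ≤ L) (r : ℕ) (ζ : Jet 3 2 L) :
    detOf (outputAt L hL (r + 4) ζ) = ratioIter L 1 ζ ^ 3 + ratioIter L 2 ζ := rfl

theorem reducedOf_outputAt (hL : 1 ≤ L) (r : ℕ) (hζ : ζ ∈ regularJets L) :
    reducedAOf (outputAt L hL (r + 4) ζ) = reducedA L ζ ∧
      reducedBOf (outputAt L hL (r + 4) ζ) = reducedB L ζ :=
  ⟨reducedAOf_eq (η := outputAt L hL (r + 4) ζ) hζ.2 (secondOutput_eq hL hζ.1)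
      (lieD_secondOutput hL hζ.1),
    reducedBOf_eq (η := outputAt L hL (r + 4) ζ) hζ.2 (secondOutput_eq hL hζ.1)
      (lieD_secondOutput hL hζ.1)⟩

theorem state₁Of_outputAt (hL : 1 ≤ L) (r : ℕ) (hζ : ζ ∈ regularJets L) :
    state₁Of (outputAt L hL (r + 4) ζ) = ζ.1 0 := by
  have h2 : outputAt L hL (r + 4) ζ 2 1 = _ := lieD_iterate_two_secondOutput hL hζ.1
  have e (j : Fin (r + 4)) : outputAt L hL (r + 4) ζ j 0 = ratioIter L j ζ := rfl
  rw [state₁Of, (reducedOf_outputAt hL r hζ).1, (reducedOf_outputAt hL r hζ).2, detOf_outputAt,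
    div_eq_iff hζ.2, h2, e, e, e, e]
  show (2 * ratioIter L 3 ζ * reducedB L ζ - 2 * (3 * (ratioIter L 1 ζ * ratioIter L 2 ζ) +
    ratioIter L 0 ζ * ratioIter L 3 ζ) * reducedA L ζ +
    2 * (ratioIter L 1 ζ * (ratioIter L 1 ζ * ratioIter L 1 ζ) + ratioIter L 2 ζ) * ζ.1 0) / 2 +
    (3 * ratioIter L 1 ζ * ratioIter L 2 ζ + ratioIter L 0 ζ * ratioIter L 3 ζ) * reducedA L ζ -
    ratioIter L 3 ζ * reducedB L ζ = _
  ring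

theorem stateOf_outputAt (hL : 1 ≤ L) (r : ℕ) (hζ : ζ ∈ regularJets L) :
    stateOf (outputAt L hL (r + 4) ζ) = ζ.1 := by
  have e : outputAt L hL (r + 4) ζ 0 0 = inputRatio L ζ := rfl
  rw [stateOf, (reducedOf_outputAt hL r hζ).1, (reducedOf_outputAt hL r hζ).2,
    state₁Of_outputAt hL r hζ, e]
  ext k
  fin_cases k
  · rfl
  · simp [reducedA]
  · simp [reducedB]; ring

theorem inputOf_outputAt (hL : 1 ≤ L) (hζ : ζ ∈ regularJets L) :
    inputOf (outputAt L hL 5 ζ) = ζ.2 0 := by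
  have hu := ne_zero_of_mem_jetDomain hζ.1
  have h3 : outputAt L hL 5 ζ 3 1 = _ := lieD_iterate_three_secondOutput hL hζ.1
  have e (j : Fin 5) : outputAt L hL 5 ζ j 0 = ratioIter L j ζ := rfl
  have h1 : input₁Of (outputAt L hL 5 ζ) = ζ.2 0 0 := by
    rw [input₁Of, (reducedOf_outputAt hL 1 hζ).1, (reducedOf_outputAt hL 1 hζ).2,
      detOf_outputAt hL 1, state₁Of_outputAt hL 1 hζ, div_eq_iff hζ.2, h3, e, e, e, e, e]
    simp only [Fin.val_zero, Fin.val_one, show (2 : Fin 5).val = 2 from rfl,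
      show (3 : Fin 5).val = 3 from rfl, show (4 : Fin 5).val = 4 from rfl]
    ring
  have e0 : outputAt L hL 5 ζ 0 0 = ζ.2 0 1 / ζ.2 0 0 := rfl
  rw [inputOf, h1, e0]
  ext k
  fin_cases k
  · rfl
  · simp [hu]

theorem isFlatOutputAt_exampleOutput {ξ₀ : InfJet 3 2} (hξ₀ : ξ₀ ∈ exampleRegularSet) :
    exampleSystem.IsFlatOutputAt exampleOutput ξ₀ := by
  have hL : 1 ≤ 5 := by norm_num
  have hout {N : ℕ} (hN : N ≤ 5) {ξ : InfJet 3 2} (hξ : ξ ∈ exampleRegularSet) :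
      exampleSystem.outputJet exampleOutput N ξ = outputAt 5 hL N (ξ.trunc 5) :=
    outputJet_exampleOutput hL hN hξ.1
  have hreg {ξ : InfJet 3 2} (hξ : ξ ∈ exampleRegularSet) : ξ.trunc 5 ∈ regularJets 5 :=
    (mem_exampleRegularSet_iff (by norm_num) ξ).1 hξ
  refine ⟨hξ₀.1, ⟨_, isOpen_setOf_input_ne_zero, hξ₀.1, contDiffOn_exampleOutput⟩, 4,
    stateOf (r := 0), inputOf, ⟨_, isOpen_setOf_detOf_ne_zero, ?_, contDiffOn_stateOf⟩,
    ⟨_, isOpen_setOf_detOf_ne_zero (r := 1), ?_, contDiffOn_inputOf⟩, ?_⟩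
  · rw [hout (by norm_num) hξ₀]; exact (hreg hξ₀).2
  · rw [hout le_rfl hξ₀]; exact (hreg hξ₀).2
  · filter_upwards [isOpen_exampleRegularSet.mem_nhds hξ₀] with ξ hξ
    rw [hout (by norm_num) hξ, hout le_rfl hξ]
    exact ⟨(stateOf_outputAt hL 0 (hreg hξ)).symm, (inputOf_outputAt hL (hreg hξ)).symm⟩

end ExplicitFlatOutput

end

theorem proposition2 :
    -- the explicit output is an `(x, u, u̇)`-flat output around every point of an open dense set
    (IsOpen exampleRegularSet ∧ Dense exampleRegularSet ∧
      ∀ ξ ∈ exampleRegularSet, exampleSystem.IsFlatOutputAt exampleOutput ξ) ∧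
    -- no `(x, u)`-flat output exists around any point
    ¬ exampleSystem.HasFlatOutput 0 := by
  exact ⟨⟨isOpen_exampleRegularSet, dense_exampleRegularSet, fun _ => isFlatOutputAt_exampleOutput⟩,
    not_hasFlatOutput_zero⟩
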